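/- **Rank Theorem.** Let ${\mathbf k}$ be an infinite field (of any characteristic, not necessarily algebraically closed), $V={\mathbf k}^n$, and let ${\mathbf b}=(b_1,\dots,b_q)$, ${\mathbf c}=(c_1,\dots,c_r)$ be compositions of $n$, i.e. lists of positive integers with sum $n$. Let $\mathrm{Flag}({\mathbf b})$ be the variety of partial flags $0=B_0\subset B_1\subset\cdots\subset B_q=V$ with $\dim(B_i/B_{i-1})=b_i$, and similarly $\mathrm{Flag}({\mathbf c})$. The group $GL(V)$ acts diagonally on the set of ${\mathbf k}$-points of $X=\mathbb P(V)\times\mathrm{Flag}({\mathbf b})\times\mathrm{Flag}({\mathbf c})$, whose elements are the triple flags $(A,B_\bullet,C_\bullet)$. Closures are taken in the Zariski topology on these ${\mathbf k}$-points, whose closed sets are the zero loci of multihomogeneous polynomials in the Plücker coordinates of $A$, the $B_i$ and the $C_j$. A *decorated matrix* $(M,\Delta)$ consists of a $q\times r$ matrix $M=(m_{ij})$ of nonnegative integers with row sums $b_i$ and column sums $c_j$, and a nonempty set of positions $\Delta=\{(i_1,j_1),\dots,(i_t,j_t)\}$ with $i_1<\cdots<i_t$, $j_1>\cdots>j_t$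 and $m_{ij}>0$ for all $(i,j)\in\Delta$. Let $F_{M,\Delta}$ be the set of triple flags $(A,B_\bullet,C_\bullet)$ for which there is a basis $(v_{ijk})$, $1\le i\le q$, $1\le j\le r$, $1\le k\le m_{ij}$, of $V$ with $$B_i=\langle v_{i'jk}\mid i'\le i\rangle,\qquad C_j=\langle v_{ij'k}\mid j'\le j\rangle,\qquad A=\Big\langle \sum_{(i,j)\in\Delta}v_{ij1}\Big\rangle .$$ For $(i,j)\in[0,q]\times[0,r]$ put $r_{ij}(M)=\sum_{k\le i,\,l\le j}m_{kl}$ and $r_{\langle ij\rangle}(M,\Delta)=r_{ij}(M)+\delta_{ij}(\Delta)$, where $\delta_{ij}(\Delta)=0$ if there is $(i',j')\in\Delta$ with $i'>i$ and $j'>j$, and $\delta_{ij}(\Delta)=1$ otherwise. 1. The sets $F_{M,\Delta}$ are exactly the $GL(V)$-orbits: each is nonempty and a single orbit, and every triple flag lies in $F_{M,\Delta}$ for exactly one decorated matrix $(M,\Delta)$. For $(A,B_\bullet,C_\bullet)\in F_{M,\Delta}$ and all $(i,j)\in[0,q]\times[0,r]$, $$r_{ij}(M)=\dim(B_i\cap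 C_j),\qquad r_{\langle ij\rangle}(M,\Delta)=\dim(B_i\cap C_j)+\dim(A\cap(B_i+C_j)).$$ 2. For all decorated matrices $(M,\Delta)$, $(M',\Delta')$ (with the same ${\mathbf b}$, ${\mathbf c}$), $$F_{M,\Delta}\subset\overline{F_{M',\Delta'}}\iff r_{ij}(M)\ge r_{ij}(M')\ \text{ and }\ r_{\langle ij\rangle}(M,\Delta)\ge r_{\langle ij\rangle}(M',\Delta')\ \text{ for all }(i,j)\in[0,q]\times[0,r].$$ 3. That is, for all triple flags $(A,B_\bullet,C_\bullet)$ and $(A',B'_\bullet,C'_\bullet)$ in $X$, the first lies in the closure of the $GL(V)$-orbit of the second if and only if, for all $(i,j)\in[0,q]\times[0,r]$, $\dim(B_i\cap C_j)\ge\dim(B'_i\cap C'_j)$ and $$\dim(B_i\cap C_j)+\dim(A\cap(B_i+C_j))\ge\dim(B'_i\cap C'_j)+\dim(A'\cap(B'_i+C'_j)).$$ -/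

import Mathlib

open scoped LinearAlgebra.Projectivization

/-- `b 0 + ⋯ + b (i - 1)`: the dimension of the `i`-th space of a flag whose successive quotients
have dimensions `b 0, b 1, …`. -/
def partialSum {q : ℕ} (b : Fin q → ℕ) (i : Fin (q + 1)) : ℕ :=
  ∑ a : Fin q, if a.val < i.val then b a else 0

/-- A point of `Flag(b)`: a partial flag `0 = B_0 ⊆ B_1 ⊆ ⋯ ⊆ B_q = k ^ n` with
`dim (B_i / B_{i-1}) = b_i`. -/
@[ext]
structure PartialFlag (k : Type*) [Field k] (n : ℕ) {q : ℕ} (b : Fin q → ℕ) where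
  space : Fin (q + 1) → Submodule k (Fin n → k)
  space_zero : space 0 = ⊥
  space_last : space (Fin.last q) = ⊤
  mono : Monotone space
  finrank_succ : ∀ i : Fin q,
    Module.finrank k (space i.succ) = Module.finrank k (space i.castSucc) + b i

/-- A point of `ℙ(V) × Flag(b) × Flag(c)`, where `V = k ^ n`: a line `A` and two flags `B`, `C`. -/
@[ext]
structure TripleFlag (k : Type*) [Field k] (n : ℕ) {q r : ℕ} (b : Fin q → ℕ) (c : Fin r → ℕ) where
  line : ℙ k (Fin n → k)
  fst : PartialFlag k n b
  snd : PartialFlag k n c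

section Action

variable {k : Type*} [Field k] {n : ℕ}

instance PartialFlag.instMulAction {q : ℕ} (b : Fin q → ℕ) :
    MulAction (LinearMap.GeneralLinearGroup k (Fin n → k)) (PartialFlag k n b) where
  smul g F :=
    { space := fun i => (F.space i).map g.toLinearEquiv.toLinearMap
      space_zero := by rw [F.space_zero, Submodule.map_bot]
      space_last := by
        rw [F.space_last, Submodule.map_top]
        exact LinearEquiv.range _
      mono := fun _ _ h => Submodule.map_mono (F.mono h)
      finrank_succ := fun i => by
        rw [LinearEquiv.finrank_map_eq, LinearEquiv.finrank_map_eq]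
        exact F.finrank_succ i }
  one_smul F := by
    ext i : 2
    exact Submodule.map_id _
  mul_smul g h F := by
    ext i : 2
    exact Submodule.map_comp h.toLinearEquiv.toLinearMap g.toLinearEquiv.toLinearMap _

/-- The diagonal action of `GL(V)` on triple flags. -/
instance TripleFlag.instMulAction {q r : ℕ} (b : Fin q → ℕ) (c : Fin r → ℕ) :
    MulAction (LinearMap.GeneralLinearGroup k (Fin n → k)) (TripleFlag k n b c) where
  smul g x := ⟨g • x.line, g • x.fst, g • x.snd⟩
  one_smul _ := TripleFlag.ext (one_smul _ _) (one_smul _ _) (one_smul _ _)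
  mul_smul _ _ _ := TripleFlag.ext (mul_smul _ _ _) (mul_smul _ _ _) (mul_smul _ _ _)

end Action

section Zariski

/-- Labels of the subspaces that make up a triple flag: `A`, then `B_0, …, B_q`,
then `C_0, …, C_r`. -/
abbrev SpaceLabel (q r : ℕ) : Type := Unit ⊕ Fin (q + 1) ⊕ Fin (r + 1)

/-- The dimension of the subspace with a given label. -/
def labelDim {q r : ℕ} (b : Fin q → ℕ) (c : Fin r → ℕ) : SpaceLabel q r → ℕ :=
  Sum.elim (fun _ => 1) (Sum.elim (partialSum b) (partialSum c))

/-- Indices of the Plücker coordinates of a triple flag: a label `s` together with a `d`-tuple of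
elements of `{0, …, n - 1}`, where `d` is the dimension of the subspace labelled `s`. (All tuples
are used; the coordinates are alternating in the tuple.) -/
abbrev PluckerIndex (n : ℕ) {q r : ℕ} (b : Fin q → ℕ) (c : Fin r → ℕ) : Type :=
  Σ s : SpaceLabel q r, Fin (labelDim b c s) → Fin n

variable {k : Type*} [Field k] {n q r : ℕ} {b : Fin q → ℕ} {c : Fin r → ℕ}

/-- The subspace of `V` with a given label. -/
def TripleFlag.space (x : TripleFlag k n b c) : SpaceLabel q r → Submodule k (Fin n → k) :=
  Sum.elim (fun _ => x.line.submodule) (Sum.elim x.fst.space x.snd.space)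

/-- `p` is a system of Plücker (multi-homogeneous) coordinates of `x`: for each of the subspaces of
`x` one chooses a basis, and the coordinates are the maximal minors of the matrices whose columns
are these bases. -/
def TripleFlag.IsPlucker (x : TripleFlag k n b c) (p : PluckerIndex n b c → k) : Prop :=
  ∃ X : (s : SpaceLabel q r) → Fin (labelDim b c s) → (Fin n → k),
    (∀ s, LinearIndependent k (X s)) ∧ (∀ s, Submodule.span k (Set.range (X s)) = x.space s) ∧
      ∀ (s : SpaceLabel q r) (I : Fin (labelDim b c s) → Fin n),
        p ⟨s, I⟩ = (Matrix.of fun i j => X s j (I i)).det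

/-- Multi-homogeneous polynomials in the Plücker coordinates, of degree `e s` in the coordinates of
the subspace labelled `s`. -/
def IsMultihomogeneous (P : MvPolynomial (PluckerIndex n b c) k) (e : SpaceLabel q r → ℕ) : Prop :=
  P.IsWeightedHomogeneous (fun t : PluckerIndex n b c => (Pi.single t.1 1 : SpaceLabel q r → ℕ)) e

/-- The polynomial `P` vanishes at the point `x`. -/
def TripleFlag.Vanishes (P : MvPolynomial (PluckerIndex n b c) k) (x : TripleFlag k n b c) : Prop :=
  ∃ p, x.IsPlucker p ∧ MvPolynomial.eval p P = 0

/-- The common zero locus of a set of polynomials. -/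
def TripleFlag.zeroLocus (S : Set (MvPolynomial (PluckerIndex n b c) k)) :
    Set (TripleFlag k n b c) :=
  {x | ∀ P ∈ S, x.Vanishes P}

/-- The subsets of `ℙ(V) × Flag(b) × Flag(c)` that are cut out by multi-homogeneous polynomials in
the Plücker coordinates. -/
def TripleFlag.IsAlgebraic (Z : Set (TripleFlag k n b c)) : Prop :=
  ∃ S : Set (MvPolynomial (PluckerIndex n b c) k),
    (∀ P ∈ S, ∃ e, IsMultihomogeneous P e) ∧ Z = TripleFlag.zeroLocus S

theorem partialSum_succ {q : ℕ} (b : Fin q → ℕ) (i : Fin q) :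
    partialSum b i.succ = partialSum b i.castSucc + b i := by
  have h : ∀ a : Fin q, (if a.val < i.succ.val then b a else 0) =
      (if a.val < i.castSucc.val then b a else 0) + if a = i then b a else 0 := by
    intro a
    rcases lt_trichotomy a i with h | h | h
    · have h' : a.val < i.val := h
      simp [h.ne, h', Nat.lt_succ_of_lt h']
    · simp [h]
    · have h' : i.val < a.val := h
      simp [h.ne', not_lt.2 h'.le, Nat.not_lt.2 (Nat.succ_le_of_lt h')]
  simp only [partialSum, h, Finset.sum_add_distrib, Finset.sum_ite_eq', Finset.mem_univ, if_true]

theorem PartialFlag.finrank_space {q : ℕ} {b : Fin q → ℕ} (F : PartialFlag k n b)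
    (i : Fin (q + 1)) : Module.finrank k (F.space i) = partialSum b i := by
  induction i using Fin.induction with
  | zero => simp [F.space_zero, partialSum]
  | succ i ih => rw [F.finrank_succ, ih, partialSum_succ]

theorem TripleFlag.finrank_space (x : TripleFlag k n b c) (s : SpaceLabel q r) :
    Module.finrank k (x.space s) = labelDim b c s := by
  rcases s with _ | i | j
  · exact x.line.finrank_submodule
  · exact x.fst.finrank_space i
  · exact x.snd.finrank_space j

theorem TripleFlag.exists_isPlucker (x : TripleFlag k n b c) : ∃ p, x.IsPlucker p := by
  let B := fun s => Module.finBasisOfFinrankEq k (x.space s) (x.finrank_space s)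
  refine ⟨fun t => (Matrix.of fun i j => ((B t.1 j : x.space t.1) : Fin n → k) (t.2 i)).det,
    fun s j => B s j, fun s => ?_, fun s => ?_, fun s I => rfl⟩
  · exact (B s).linearIndependent.map' (x.space s).subtype (Submodule.ker_subtype _)
  · have h := congrArg (Submodule.map (x.space s).subtype) (B s).span_eq
    rw [Submodule.map_span, Submodule.map_top, Submodule.range_subtype, ← Set.range_comp] at h
    exact h

/-- Any two systems of Plücker coordinates of a point differ by one scalar for each subspace. -/
theorem TripleFlag.IsPlucker.exists_scale {x : TripleFlag k n b c} {p p' : PluckerIndex n b c → k}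
    (hp : x.IsPlucker p) (hp' : x.IsPlucker p') :
    ∃ l : SpaceLabel q r → k, ∀ t, p' t = l t.1 * p t := by
  obtain ⟨X, -, hX, hpX⟩ := hp
  obtain ⟨X', -, hX', hpX'⟩ := hp'
  have key : ∀ s j, ∃ T : Fin (labelDim b c s) → k, ∑ i, T i • X s i = X' s j := by
    intro s j
    rw [← Submodule.mem_span_range_iff_exists_fun, hX s, ← hX' s]
    exact Submodule.subset_span ⟨j, rfl⟩
  choose T hT using key
  refine ⟨fun s => (Matrix.of fun i j => T s j i).det, ?_⟩
  rintro ⟨s, I⟩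
  rw [hpX, hpX', mul_comm, ← Matrix.det_mul]
  congr 1
  ext i j
  simp [Matrix.mul_apply, ← hT s j, mul_comm]

/-- Vanishing of a multi-homogeneous polynomial does not depend on the choice of coordinates. -/
theorem TripleFlag.vanishes_iff {P : MvPolynomial (PluckerIndex n b c) k}
    {e : SpaceLabel q r → ℕ} (hP : IsMultihomogeneous P e) {x : TripleFlag k n b c}
    {p : PluckerIndex n b c → k} (hp : x.IsPlucker p) :
    x.Vanishes P ↔ MvPolynomial.eval p P = 0 := by
  refine ⟨?_, fun h => ⟨p, hp, h⟩⟩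
  rintro ⟨p', hp', h⟩
  obtain ⟨l, hl⟩ := hp'.exists_scale hp
  have : MvPolynomial.eval p P = (∏ s, l s ^ e s) * MvPolynomial.eval p' P := by
    rw [MvPolynomial.eval_eq', MvPolynomial.eval_eq', Finset.mul_sum]
    refine Finset.sum_congr rfl fun d hd => ?_
    have hd' := hP (MvPolynomial.mem_support_iff.1 hd)
    have h2 : ∏ t, l t.1 ^ d t = ∏ s, l s ^ e s := by
      rw [← hd', Fintype.prod_sigma]
      refine Finset.prod_congr rfl fun s _ => ?_
      change ∏ I, l s ^ d ⟨s, I⟩ = _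
      rw [Finset.prod_pow_eq_pow_sum, Finsupp.weight_apply, Finsupp.sum_fintype _ _ (by simp)]
      congr 1
      rw [Finset.sum_apply, Fintype.sum_sigma, Finset.sum_eq_single s]
      · simp
      · intro s' _ hs'
        simp [Pi.single_eq_of_ne hs'.symm]
      · simp
    simp only [hl, mul_pow, Finset.prod_mul_distrib, h2]
    ring
  rw [this, h, mul_zero]

/-- The Zariski topology on the set of `k`-points of `ℙ(V) × Flag(b) × Flag(c)`. -/
instance TripleFlag.zariskiTopology : TopologicalSpace (TripleFlag k n b c) :=
  TopologicalSpace.ofClosed {Z | TripleFlag.IsAlgebraic Z}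
    (by
      refine ⟨{1}, ?_, ?_⟩
      · rintro P rfl
        exact ⟨0, MvPolynomial.isWeightedHomogeneous_one _ _⟩
      · symm
        rw [Set.eq_empty_iff_forall_notMem]
        intro x hx
        obtain ⟨p, -, h⟩ := hx 1 rfl
        simp at h)
    (by
      intro 𝒵 h𝒵
      have h𝒵' : ∀ Z ∈ 𝒵, TripleFlag.IsAlgebraic Z := fun Z hZ => h𝒵 hZ
      choose! S hS hZ using h𝒵'
      refine ⟨⋃ Z ∈ 𝒵, S Z, ?_, ?_⟩
      · intro P hP
        simp only [Set.mem_iUnion] at hP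
        obtain ⟨Z, hZm, hP⟩ := hP
        exact hS Z hZm P hP
      · ext x
        simp only [Set.mem_sInter, TripleFlag.zeroLocus, Set.mem_iUnion, Set.mem_ofPred_eq]
        constructor
        · rintro h P ⟨Z, hZm, hP⟩
          have := h Z hZm
          rw [hZ Z hZm] at this
          exact this P hP
        · intro h Z hZm
          rw [hZ Z hZm]
          exact fun P hP => h P ⟨Z, hZm, hP⟩)
    (by
      rintro Z ⟨S, hS, rfl⟩ Z' ⟨S', hS', rfl⟩
      refine ⟨{Q | ∃ P ∈ S, ∃ P' ∈ S', Q = P * P'}, ?_, ?_⟩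
      · rintro Q ⟨P, hP, P', hP', rfl⟩
        obtain ⟨e, he⟩ := hS P hP
        obtain ⟨e', he'⟩ := hS' P' hP'
        exact ⟨e + e', MvPolynomial.IsWeightedHomogeneous.mul he he'⟩
      · ext x
        constructor
        · rintro (h | h) Q ⟨P, hP, P', hP', rfl⟩
          · obtain ⟨p, hp, h0⟩ := h P hP
            exact ⟨p, hp, by rw [map_mul, h0, zero_mul]⟩
          · obtain ⟨p, hp, h0⟩ := h P' hP'
            exact ⟨p, hp, by rw [map_mul, h0, mul_zero]⟩
        · intro h
          by_contra hx
          simp only [Set.mem_union, not_or, TripleFlag.zeroLocus, Set.mem_ofPred_eq,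
            not_forall] at hx
          obtain ⟨⟨P, hP, h1⟩, ⟨P', hP', h2⟩⟩ := hx
          obtain ⟨p, hp, h0⟩ := h _ ⟨P, hP, P', hP', rfl⟩
          rw [map_mul] at h0
          rcases mul_eq_zero.1 h0 with h0 | h0
          · exact h1 ⟨p, hp, h0⟩
          · exact h2 ⟨p, hp, h0⟩)

end Zariski

section DecoratedMatrices

/-- Decorated matrices `(M, Δ)`: a `q × r` matrix `M` of nonnegative integers with row sums `b` and
column sums `c`, and a nonempty set `Δ` of positions of positive entries of `M` that proceed
strictly from northeast to southwest. Rows and columns are numbered from `0`. -/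
structure DecoratedMatrix {q r : ℕ} (b : Fin q → ℕ) (c : Fin r → ℕ) where
  M : Matrix (Fin q) (Fin r) ℕ
  row_sum : ∀ i, ∑ j, M i j = b i
  col_sum : ∀ j, ∑ i, M i j = c j
  Δ : Finset (Fin q × Fin r)
  nonempty : Δ.Nonempty
  descending : ∀ p ∈ Δ, ∀ p' ∈ Δ, p ≠ p' →
    (p.1 < p'.1 ∧ p'.2 < p.2) ∨ (p'.1 < p.1 ∧ p.2 < p'.2)
  pos : ∀ p ∈ Δ, 0 < M p.1 p.2

namespace DecoratedMatrix

variable {q r : ℕ} {b : Fin q → ℕ} {c : Fin r → ℕ}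

/-- The rank number `r_ij(M)`: the sum of the entries in the first `i` rows and `j` columns. -/
def rankNum (D : DecoratedMatrix b c) (i : Fin (q + 1)) (j : Fin (r + 1)) : ℕ :=
  ∑ a : Fin q, ∑ d : Fin r, if a.val < i.val ∧ d.val < j.val then D.M a d else 0

open Classical in
/-- `δ_ij(Δ)`: it is `0` if some position of `Δ` lies strictly below the first `i` rows and strictly
to the right of the first `j` columns, and `1` otherwise. -/
noncomputable def delta (D : DecoratedMatrix b c) (i : Fin (q + 1)) (j : Fin (r + 1)) : ℕ :=
  if ∃ p ∈ D.Δ, i.val ≤ p.1.val ∧ j.val ≤ p.2.val then 0 else 1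

/-- The rank number `r_⟨ij⟩(M, Δ) = r_ij(M) + δ_ij(Δ)`. -/
noncomputable def rankNumBar (D : DecoratedMatrix b c) (i : Fin (q + 1)) (j : Fin (r + 1)) : ℕ :=
  D.rankNum i j + D.delta i j

/-- The set `F_{M,Δ}` of the triple flags `(A, B, C)` for which there is a basis `v_{ijk}`
(`1 ≤ k ≤ m_ij`) of `V` such that `B_i` is spanned by the basis vectors of the first `i` rows, `C_j`
by those of the first `j` columns, and `A` by the sum of the `v_{ij1}` over `(i,j) ∈ Δ`. -/
def orbit (k : Type*) [Field k] (n : ℕ) (D : DecoratedMatrix b c) : Set (TripleFlag k n b c) :=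
  {x | ∃ v : Module.Basis (Σ a : Fin q, Σ d : Fin r, Fin (D.M a d)) k (Fin n → k),
    (∀ i, x.fst.space i = Submodule.span k (v '' {t | t.1.val < i.val})) ∧
    (∀ j, x.snd.space j = Submodule.span k (v '' {t | t.2.1.val < j.val})) ∧
    x.line.submodule =
      Submodule.span k {∑ p : D.Δ, v ⟨p.1.1, p.1.2, ⟨0, D.pos p.1 p.2⟩⟩}}

end DecoratedMatrix

end DecoratedMatrices

section GeometricRanks

variable {k : Type*} [Field k] {n q r : ℕ} {b : Fin q → ℕ} {c : Fin r → ℕ}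

/-- `dim (B_i ∩ C_j)`. -/
noncomputable def TripleFlag.rankNum (x : TripleFlag k n b c) (i : Fin (q + 1)) (j : Fin (r + 1)) :
    ℕ :=
  Module.finrank k ↥(x.fst.space i ⊓ x.snd.space j)

/-- `dim (B_i ∩ C_j) + dim (A ∩ (B_i + C_j))`. -/
noncomputable def TripleFlag.rankNumBar (x : TripleFlag k n b c) (i : Fin (q + 1))
    (j : Fin (r + 1)) : ℕ :=
  Module.finrank k ↥(x.fst.space i ⊓ x.snd.space j) +
    Module.finrank k ↥(x.line.submodule ⊓ (x.fst.space i ⊔ x.snd.space j))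

end GeometricRanks

/-! By the dimension formula, the two rank functions are constants minus `dim (B_i + C_j)` and `dim
(A + B_i + C_j)` (`rankNum_add_sumRank`). Such sum dimensions can only drop in a closure, since
bounding them amounts to the vanishing of minors (`isClosed_finrank_le`). This gives the necessity
of the inequalities.

For sufficiency, the flags are first refined to complete ones: generically for the larger triple,
arbitrarily for the smaller (`exists_frames`). Complete triples are represented by frames, a vector
and two spanning sequences. Plücker coordinates are polynomial in the frame, so limits may be taken
in a vector space (`mem_closure_of_mem_polyHull`).

For frames `y ≤ y'` the argument is an induction on the total rank of `y'`
(`mem_polyHull_rankCell`). Let `B_{i+1}` vary in the pencil of spaces between `B_i` and `B_{i+2}`.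
If the member belonging to `y'` is generic with respect to all `C_j` and `A + C_j`, then the closure
of the cell of `y'` contains every triple with the same ranks in the other rows
(`mem_polyHull_of_isGenericRow`). Special members of the two pencils give `z ≤ z' < y'`
(`exists_lift`). By induction `z` is a limit of the cell of `z'`, and changing the member of the
pencil back shows that `y` is a limit of the cell of `y'`. Columns are symmetric. If no row and no
column is generic, the flags of `y'` coincide (`eq_max`), and only the position of `A` in one flag
is left (`mem_polyHull_of_eq_max`).

Orbits are classified by expanding a vector of `A` in a basis adapted to both flags: the maximal
positions of its support form `Δ`, and grouping the terms below them yields new basis vectors whose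
sum spans `A` (`exists_mem_orbit`). Rank numbers recover `M` by differences and `Δ` as an antichain
(`eq_of_rankNum_eq`). -/

/-! ### Polynomial functions and Zariski closure in a vector space. -/

section PolynomialHull

variable {k E F : Type*} [Field k] [AddCommGroup E] [Module k E] [AddCommGroup F] [Module k F]

/-- The algebra of polynomial functions on a vector space. -/
def polyFun (k E : Type*) [Field k] [AddCommGroup E] [Module k E] : Subalgebra k (E → k) :=
  Algebra.adjoin k (Set.range fun l : Module.Dual k E => (l : E → k))

theorem dual_mem_polyFun (l : Module.Dual k E) : (l : E → k) ∈ polyFun k E :=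
  Algebra.subset_adjoin ⟨l, rfl⟩

theorem polyFun_comp_linearMap (φ : E →ₗ[k] F) {f : F → k} (hf : f ∈ polyFun k F) :
    (fun x => f (φ x)) ∈ polyFun k E := by
  induction hf using Algebra.adjoin_induction with
  | mem f hf =>
    obtain ⟨l, rfl⟩ := hf
    exact dual_mem_polyFun (l ∘ₗ φ)
  | algebraMap c => exact (polyFun k E).algebraMap_mem c
  | add f g _ _ hf hg => exact (polyFun k E).add_mem hf hg
  | mul f g _ _ hf hg => exact (polyFun k E).mul_mem hf hg

/-- A polynomial function restricts to a polynomial on every line. -/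
theorem exists_polynomial_of_mem_polyFun {f : E → k} (hf : f ∈ polyFun k E) (x w : E) :
    ∃ p : Polynomial k, ∀ τ : k, f (x + τ • w) = p.eval τ := by
  induction hf using Algebra.adjoin_induction with
  | mem f hf =>
    obtain ⟨l, rfl⟩ := hf
    exact ⟨.C (l x) + .C (l w) * .X, fun τ => by simp [mul_comm τ]⟩
  | algebraMap c => exact ⟨.C c, fun τ => by simp⟩
  | add f g _ _ hf hg =>
    obtain ⟨p, hp⟩ := hf
    obtain ⟨p', hp'⟩ := hg
    exact ⟨p + p', fun τ => by simp [hp, hp']⟩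
  | mul f g _ _ hf hg =>
    obtain ⟨p, hp⟩ := hf
    obtain ⟨p', hp'⟩ := hg
    exact ⟨p * p', fun τ => by simp [hp, hp']⟩

/-- The Zariski closure of a subset of a vector space. -/
def polyHull (k : Type*) {E : Type*} [Field k] [AddCommGroup E] [Module k E] (S : Set E) : Set E :=
  {x | ∀ f ∈ polyFun k E, (∀ s ∈ S, f s = 0) → f x = 0}

theorem subset_polyHull (S : Set E) : S ⊆ polyHull k S := fun x hx _ _ h => h x hx

/-- Polynomial functions pull back along linear maps. As `φ s` need only be in the hull of `T`, the
lemma also absorbs a second passage to the limit. -/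
theorem map_mem_polyHull (φ : E →ₗ[k] F) {S : Set E} {T : Set F}
    (h : ∀ s ∈ S, φ s ∈ polyHull k T) {x : E} (hx : x ∈ polyHull k S) : φ x ∈ polyHull k T :=
  fun f hf hT => hx _ (polyFun_comp_linearMap φ hf) fun s hs => h s hs f hf hT

/-- A polynomial in one variable with infinitely many roots is zero, so it also vanishes at `τ = 0`.
All degenerations below come from such lines; this is where the field has to be infinite. -/
theorem mem_polyHull_of_line [Infinite k] {S : Set E} (x w : E) {bad : Set k} (hbad : bad.Finite)
    (h : ∀ τ, τ ∉ bad → x + τ • w ∈ S) : x ∈ polyHull k S := by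
  intro f hf hS
  obtain ⟨p, hp⟩ := exists_polynomial_of_mem_polyFun hf x w
  have : p = 0 := by
    refine Polynomial.eq_zero_of_infinite_isRoot p ((hbad.infinite_compl).mono fun τ hτ => ?_)
    change p.eval τ = 0
    rw [← hp]
    exact hS _ (h τ hτ)
  have h0 := hp 0
  rwa [zero_smul, add_zero, this, Polynomial.eval_zero] at h0

end PolynomialHull

/-! ### Pencils of subspaces and their special members. -/

section Pencil

variable {k V : Type*} [Field k] [AddCommGroup V] [Module k V]

open Submodule Module

theorem finrank_sup_span_singleton_of_mem {S : Submodule k V} {u : V} (h : u ∈ S) :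
    finrank k ↥(S ⊔ span k {u}) = finrank k S := by
  rw [sup_eq_left.2 (by simpa using h)]

variable [FiniteDimensional k V]

theorem finrank_sup_span_singleton_of_notMem {S : Submodule k V} {u : V} (h : u ∉ S) :
    finrank k ↥(S ⊔ span k {u}) = finrank k S + 1 := by
  have h1 := finrank_sup_add_finrank_inf_eq S (span k {u})
  have h2 : S ⊓ span k {u} = ⊥ := by
    rw [← disjoint_iff, disjoint_comm]
    exact (disjoint_span_singleton' (by rintro rfl; exact h S.zero_mem)).2 h |>.symm
  rw [h2, finrank_bot, finrank_span_singleton (by rintro rfl; exact h S.zero_mem)] at h1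
  omega

theorem finrank_sup_span_singleton_le (S : Submodule k V) (u : V) :
    finrank k ↥(S ⊔ span k {u}) ≤ finrank k S + 1 := by
  by_cases h : u ∈ S
  · rw [finrank_sup_span_singleton_of_mem h]; omega
  · rw [finrank_sup_span_singleton_of_notMem h]

theorem mem_of_finrank_sup_span_singleton_le {S : Submodule k V} {u : V}
    (h : finrank k ↥(S ⊔ span k {u}) ≤ finrank k S) : u ∈ S := by
  by_contra hu
  rw [finrank_sup_span_singleton_of_notMem hu] at h
  omega

/-- The bounds on the dimension of `P + ⟨u⟩ + N`, where `u` is in the pencil of `e` and `f`. -/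
theorem pencil_bounds (P N : Submodule k V) {e f u : V} {s t : k} (hst : s ≠ 0 ∨ t ≠ 0)
    (hu : u = s • e + t • f) :
    finrank k ↥(P ⊔ N) ≤ finrank k ↥(P ⊔ span k {u} ⊔ N) ∧
    finrank k ↥(P ⊔ span k {u} ⊔ N) ≤ finrank k ↥(P ⊔ N) + 1 ∧
    finrank k ↥(P ⊔ span k {u} ⊔ N) ≤ finrank k ↥(P ⊔ span k {e} ⊔ span k {f} ⊔ N) ∧
    finrank k ↥(P ⊔ span k {e} ⊔ span k {f} ⊔ N) ≤ finrank k ↥(P ⊔ span k {u} ⊔ N) + 1 ∧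
    (u ∈ P ⊔ N ↔ finrank k ↥(P ⊔ span k {u} ⊔ N) = finrank k ↥(P ⊔ N)) := by
  have e1 : P ⊔ span k {u} ⊔ N = P ⊔ N ⊔ span k {u} := sup_right_comm _ _ _
  have hmem : u ∈ span k {e} ⊔ span k {f} := by
    rw [hu]
    exact add_mem (mem_sup_left (smul_mem _ _ (mem_span_singleton_self e)))
      (mem_sup_right (smul_mem _ _ (mem_span_singleton_self f)))
  have hle : P ⊔ span k {u} ⊔ N ≤ P ⊔ span k {e} ⊔ span k {f} ⊔ N := by
    rw [sup_assoc P (span k {e})]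
    refine sup_le_sup_right (sup_le_sup_left ?_ _) _
    simpa using hmem
  -- One of `s`, `t` is nonzero, so `u` and a single further vector generate both `e` and `f`.
  have hex : ∃ w, P ⊔ span k {e} ⊔ span k {f} ⊔ N ≤ P ⊔ span k {u} ⊔ N ⊔ span k {w} := by
    have hu' : ∀ w, u ∈ P ⊔ span k {u} ⊔ N ⊔ span k {w} := fun w =>
      mem_sup_left (mem_sup_left (mem_sup_right (mem_span_singleton_self u)))
    rcases hst with h | h
    · refine ⟨f, ?_⟩
      have hf : f ∈ P ⊔ span k {u} ⊔ N ⊔ span k {f} := mem_sup_right (mem_span_singleton_self f)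
      have he : e ∈ P ⊔ span k {u} ⊔ N ⊔ span k {f} := by
        have : e = s⁻¹ • (u - t • f) := by rw [hu, add_sub_cancel_right, inv_smul_smul₀ h]
        rw [this]
        exact smul_mem _ _ (sub_mem (hu' f) (smul_mem _ _ hf))
      refine sup_le (sup_le (sup_le ?_ (by simpa using he)) (by simp)) ?_
      · exact le_sup_left.trans (le_sup_left.trans le_sup_left)
      · exact le_sup_right.trans le_sup_left
    · refine ⟨e, ?_⟩
      have hf : e ∈ P ⊔ span k {u} ⊔ N ⊔ span k {e} := mem_sup_right (mem_span_singleton_self e)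
      have he : f ∈ P ⊔ span k {u} ⊔ N ⊔ span k {e} := by
        have : f = t⁻¹ • (u - s • e) := by rw [hu, add_sub_cancel_left, inv_smul_smul₀ h]
        rw [this]
        exact smul_mem _ _ (sub_mem (hu' e) (smul_mem _ _ hf))
      refine sup_le (sup_le (sup_le ?_ (by simp)) (by simpa using he)) ?_
      · exact le_sup_left.trans (le_sup_left.trans le_sup_left)
      · exact le_sup_right.trans le_sup_left
  obtain ⟨w, hw⟩ := hex
  refine ⟨?_, ?_, finrank_mono hle,
    (finrank_mono hw).trans (finrank_sup_span_singleton_le _ _), ?_⟩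
  · rw [e1]; exact finrank_mono le_sup_left
  · rw [e1]; exact finrank_sup_span_singleton_le _ _
  · rw [e1]
    exact ⟨finrank_sup_span_singleton_of_mem,
      fun h => mem_of_finrank_sup_span_singleton_le h.le⟩

/-- A chain of subspaces has a common point of contact with a pencil. -/
theorem exists_special (P : Submodule k V) (e f : V) (N : ℕ → Submodule k V) (hN : Monotone N)
    (n : ℕ) (hn : N n = ⊤) :
    ∃ (u : V) (s t : k), (s ≠ 0 ∨ t ≠ 0) ∧ u = s • e + t • f ∧
      ∀ j, finrank k ↥(P ⊔ span k {e} ⊔ span k {f} ⊔ N j) ≤ finrank k ↥(P ⊔ N j) + 1 →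
        u ∈ P ⊔ N j := by
  classical
  have hex : ∃ j, finrank k ↥(P ⊔ span k {e} ⊔ span k {f} ⊔ N j) ≤ finrank k ↥(P ⊔ N j) + 1 :=
    ⟨n, by rw [hn, sup_top_eq, sup_top_eq]; omega⟩
  have hj := Nat.find_spec hex
  -- At the first index where the pencil fails to stay two-dimensional modulo `P ⊔ N j`, some member
  -- falls into this space; monotonicity keeps it there for all later indices.
  set j := Nat.find hex with hjdef
  have key : ∃ (u : V) (s t : k), (s ≠ 0 ∨ t ≠ 0) ∧ u = s • e + t • f ∧ u ∈ P ⊔ N j := by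
    by_cases he : e ∈ P ⊔ N j
    · exact ⟨e, 1, 0, by simp, by simp, he⟩
    · have h1 := finrank_sup_span_singleton_of_notMem he
      have h2 : P ⊔ span k {e} ⊔ span k {f} ⊔ N j = P ⊔ N j ⊔ span k {e} ⊔ span k {f} := by
        rw [sup_right_comm _ (span k {f}) (N j), sup_right_comm P (span k {e}) (N j)]
      rw [h2] at hj
      have hf := mem_of_finrank_sup_span_singleton_le (S := P ⊔ N j ⊔ span k {e}) (u := f)
        (by omega)
      obtain ⟨m, hm, w, hw, rfl⟩ := mem_sup.1 hf
      obtain ⟨c, rfl⟩ := mem_span_singleton.1 hw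
      exact ⟨m, -c, 1, by simp, by simp, hm⟩
  obtain ⟨u, s, t, hst, hu, hmem⟩ := key
  exact ⟨u, s, t, hst, hu, fun l hl =>
    sup_le_sup_left (hN (Nat.find_min' hex hl)) P hmem⟩

/-- The ranks of two triples of the form (pencil, chain, line) can be compared after
specializing both pencils. -/
theorem exists_lift (P P' : Submodule k V) (e f e' f' a a' : V) (N N' : ℕ → Submodule k V)
    (hN : Monotone N) (hN' : Monotone N') (n : ℕ) (hn : N n = ⊤) (hn' : N' n = ⊤)
    (hp : ∀ j, finrank k ↥(P ⊔ N j) ≤ finrank k ↥(P' ⊔ N' j))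
    (hq : ∀ j, finrank k ↥(P ⊔ span k {e} ⊔ span k {f} ⊔ N j) ≤
      finrank k ↥(P' ⊔ span k {e'} ⊔ span k {f'} ⊔ N' j))
    (hpb : ∀ j, finrank k ↥(P ⊔ (N j ⊔ span k {a})) ≤ finrank k ↥(P' ⊔ (N' j ⊔ span k {a'})))
    (hqb : ∀ j, finrank k ↥(P ⊔ span k {e} ⊔ span k {f} ⊔ (N j ⊔ span k {a})) ≤
      finrank k ↥(P' ⊔ span k {e'} ⊔ span k {f'} ⊔ (N' j ⊔ span k {a'}))) :
    ∃ (u u' : V) (s t s' t' : k), (s ≠ 0 ∨ t ≠ 0) ∧ (s' ≠ 0 ∨ t' ≠ 0) ∧ u = s • e + t • f ∧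
      u' = s' • e' + t' • f' ∧
      (∀ j, finrank k ↥(P' ⊔ span k {e'} ⊔ span k {f'} ⊔ N' j) ≤ finrank k ↥(P' ⊔ N' j) + 1 →
        u' ∈ P' ⊔ N' j) ∧
      (∀ j, finrank k ↥(P ⊔ span k {u} ⊔ N j) ≤ finrank k ↥(P' ⊔ span k {u'} ⊔ N' j)) ∧
      ∀ j, finrank k ↥(P ⊔ span k {u} ⊔ (N j ⊔ span k {a})) ≤
        finrank k ↥(P' ⊔ span k {u'} ⊔ (N' j ⊔ span k {a'})) := by
  obtain ⟨u', s', t', hst', hu', hs'⟩ := exists_special P' e' f' N' hN' n hn'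
  obtain ⟨u, s, t, hst, hu, hs⟩ := exists_special P e f N hN n hn
  have b' := fun j => pencil_bounds P' (N' j) hst' hu'
  have bb' := fun j => pencil_bounds P' (N' j ⊔ span k {a'}) hst' hu'
  have b := fun j => pencil_bounds P (N j) hst hu
  have bb := fun j => pencil_bounds P (N j ⊔ span k {a}) hst hu
  have hNb : Monotone fun j => N j ⊔ span k {a} := fun _ _ h => sup_le_sup_right (hN h) _
  have hNb' : Monotone fun j => N' j ⊔ span k {a'} := fun _ _ h => sup_le_sup_right (hN' h) _
  -- With `p`, `q` the ranks of `P` and of the whole pencil, the special `u` realizes the minimum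
  -- `max p (q - 1)` for every `j`, and each member on the primed side has at least the
  -- corresponding rank.
  have c1 : ∀ j, finrank k ↥(P ⊔ span k {u} ⊔ N j) ≤ finrank k ↥(P' ⊔ span k {u'} ⊔ N' j) := by
    intro j
    have h1 := b j
    have h2 := b' j
    have h3 := hp j
    have h4 := hq j
    have h5 := hs j
    by_cases h : finrank k ↥(P ⊔ span k {e} ⊔ span k {f} ⊔ N j) ≤ finrank k ↥(P ⊔ N j) + 1
    · have := h1.2.2.2.2.1 (h5 h)
      omega
    · omega
  -- If `u'` is generic for the chain enlarged by `a'`, any `u` satisfies the inequalities there.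
  by_cases hgen : ∀ j, finrank k ↥(P' ⊔ span k {u'} ⊔ (N' j ⊔ span k {a'})) =
      min (finrank k ↥(P' ⊔ (N' j ⊔ span k {a'})) + 1)
        (finrank k ↥(P' ⊔ span k {e'} ⊔ span k {f'} ⊔ (N' j ⊔ span k {a'})))
  · refine ⟨u, u', s, t, s', t', hst, hst', hu, hu', hs', c1, fun j => ?_⟩
    have h1 := bb j
    have h3 := hpb j
    have h4 := hqb j
    rw [hgen j]
    omega
  -- Otherwise `u'` is special for the enlarged chain as well. After `j₀` this is monotonicity. If
  -- it failed at an earlier `j`, then `u'` would generate the whole pencil modulo that space, and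
  -- the pencil would lie in the space at `j₀`, where it does not.
  have hsb' : ∀ j, finrank k ↥(P' ⊔ span k {e'} ⊔ span k {f'} ⊔ (N' j ⊔ span k {a'})) ≤
      finrank k ↥(P' ⊔ (N' j ⊔ span k {a'})) + 1 → u' ∈ P' ⊔ (N' j ⊔ span k {a'}) := by
    push Not at hgen
    obtain ⟨j₀, hj₀⟩ := hgen
    have h0 := bb' j₀
    have hmem : u' ∈ P' ⊔ (N' j₀ ⊔ span k {a'}) := h0.2.2.2.2.2 (by omega)
    intro j hj
    rcases le_total j₀ j with hle | hle
    · exact sup_le_sup_left (hNb' hle) P' hmem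
    · by_contra hnot
      have h1 := bb' j
      have h2 : finrank k ↥(P' ⊔ span k {u'} ⊔ (N' j ⊔ span k {a'})) =
          finrank k ↥(P' ⊔ span k {e'} ⊔ span k {f'} ⊔ (N' j ⊔ span k {a'})) := by
        have := mt h1.2.2.2.2.2 hnot
        omega
      have hle1 : P' ⊔ span k {u'} ⊔ (N' j ⊔ span k {a'}) ≤
          P' ⊔ span k {e'} ⊔ span k {f'} ⊔ (N' j ⊔ span k {a'}) := by
        refine sup_le_sup_right ?_ _
        rw [sup_assoc]
        refine sup_le_sup_left ?_ _
        rw [span_singleton_le_iff_mem, hu']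
        exact add_mem (mem_sup_left (smul_mem _ _ (mem_span_singleton_self e')))
          (mem_sup_right (smul_mem _ _ (mem_span_singleton_self f')))
      have h3 := eq_of_le_of_finrank_eq hle1 h2
      have h4 : P' ⊔ span k {e'} ⊔ span k {f'} ⊔ (N' j₀ ⊔ span k {a'}) ≤
          P' ⊔ (N' j₀ ⊔ span k {a'}) := by
        have h5 : P' ⊔ span k {u'} ⊔ (N' j ⊔ span k {a'}) ≤ P' ⊔ (N' j₀ ⊔ span k {a'}) :=
          sup_le (sup_le le_sup_left (by simpa using hmem)) ((hNb' hle).trans le_sup_right)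
        rw [h3] at h5
        exact sup_le (le_sup_left.trans h5) le_sup_right
      have := finrank_mono h4
      omega
  -- While `u` is special for `N`, `v` is special for the chain enlarged by `a`. One of the two
  -- serves for both chains.
  obtain ⟨v, s₂, t₂, hst₂, hv, hsv⟩ := exists_special P e f (fun j => N j ⊔ span k {a}) hNb n
    (by simp [hn])
  have d := fun j => pencil_bounds P (N j) hst₂ hv
  have db := fun j => pencil_bounds P (N j ⊔ span k {a}) hst₂ hv
  have c2 : ∀ j, finrank k ↥(P ⊔ span k {v} ⊔ (N j ⊔ span k {a})) ≤
      finrank k ↥(P' ⊔ span k {u'} ⊔ (N' j ⊔ span k {a'})) := by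
    intro j
    have h1 := db j
    have h2 := bb' j
    have h3 := hpb j
    have h4 := hqb j
    by_cases h : finrank k ↥(P ⊔ span k {e} ⊔ span k {f} ⊔ (N j ⊔ span k {a})) ≤
        finrank k ↥(P ⊔ (N j ⊔ span k {a})) + 1
    · have := h1.2.2.2.2.1 (hsv j h)
      omega
    · omega
  by_cases f1 : ∀ j, finrank k ↥(P ⊔ span k {u} ⊔ (N j ⊔ span k {a})) ≤
        finrank k ↥(P' ⊔ span k {u'} ⊔ (N' j ⊔ span k {a'}))
  · exact ⟨u, u', s, t, s', t', hst, hst', hu, hu', hs', c1, f1⟩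
  by_cases f2 : ∀ j, finrank k ↥(P ⊔ span k {v} ⊔ N j) ≤ finrank k ↥(P' ⊔ span k {u'} ⊔ N' j)
  · exact ⟨v, u', s₂, t₂, s', t', hst₂, hst', hv, hu', hs', f2, c2⟩
  -- Suppose `u` fails at `j` for the enlarged chain and `v` fails at `l` for `N`. The plan is to
  -- show `j < l` and `a ∈ P ⊔ N l`; then `v`, lying in `P ⊔ (N j ⊔ span k {a})`, lies in `P ⊔ N l`,
  -- where it must not.
  exfalso
  push Not at f1 f2
  obtain ⟨j, hj⟩ := f1
  obtain ⟨l, hl⟩ := f2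
  have mono1 : ∀ {i j : ℕ} (_ : i ≤ j) {x : V}, x ∈ P ⊔ N i → x ∈ P ⊔ N j :=
    fun h _ hx => sup_le_sup_left (hN h) P hx
  have mono1' : ∀ {i j : ℕ} (_ : i ≤ j) {x : V}, x ∈ P' ⊔ N' i → x ∈ P' ⊔ N' j :=
    fun h _ hx => sup_le_sup_left (hN' h) P' hx
  have bar : ∀ {j : ℕ} {x : V}, x ∈ P ⊔ N j → x ∈ P ⊔ (N j ⊔ span k {a}) :=
    fun hx => sup_le_sup_left le_sup_left P hx
  -- the ranks at `j` and `l`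
  have hbj := bb j
  have hb'j := bb' j
  have hpbj := hpb j
  have hqbj := hqb j
  have hsb'j : finrank k ↥(P' ⊔ span k {e'} ⊔ span k {f'} ⊔ (N' j ⊔ span k {a'})) ≤
      finrank k ↥(P' ⊔ (N' j ⊔ span k {a'})) + 1 := by omega
  have hu'j := hsb' j hsb'j
  have hu'j' := hb'j.2.2.2.2.1 hu'j
  have hunot : u ∉ P ⊔ (N j ⊔ span k {a}) := fun h => by
    have := hbj.2.2.2.2.1 h
    omega
  have hbl := d l
  have hb'l := b' l
  have hpl := hp l
  have hql := hq l
  have hs'l : finrank k ↥(P' ⊔ span k {e'} ⊔ span k {f'} ⊔ N' l) ≤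
      finrank k ↥(P' ⊔ N' l) + 1 := by omega
  have hu'l := hs' l hs'l
  have hu'l' := hb'l.2.2.2.2.1 hu'l
  have hvnot : v ∉ P ⊔ N l := fun h => by
    have := hbl.2.2.2.2.1 h
    omega
  have hlt : j < l := by
    by_contra hle
    exact hunot (bar (mono1 (not_lt.1 hle) (hs l (by omega))))
  have hd : finrank k ↥(P ⊔ N j) + 2 ≤ finrank k ↥(P ⊔ span k {e} ⊔ span k {f} ⊔ N j) := by
    by_contra h
    exact hunot (bar (hs j (by omega)))
  have ea : ∀ (S N : Submodule k V) (a : V), S ⊔ (N ⊔ span k {a}) = S ⊔ N ⊔ span k {a} :=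
    fun S N a => (sup_assoc _ _ _).symm
  -- If `u'` lies in `P' ⊔ N' j`, the alternative is excluded by counting dimensions at `j`. If not,
  -- `a'` occurs in the expression of `u'` and can be solved for.
  have ha' : a' ∈ P' ⊔ N' l := by
    by_cases h : u' ∈ P' ⊔ N' j
    · by_contra hnot
      have hnot' : a' ∉ P' ⊔ N' j := fun h => hnot (mono1' hlt.le h)
      have g1 := finrank_sup_span_singleton_of_notMem hnot'
      have g2 := finrank_sup_span_singleton_le (P' ⊔ span k {e'} ⊔ span k {f'} ⊔ N' j) a'
      have g3 := finrank_sup_span_singleton_le (P ⊔ N j) a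
      have g4 : finrank k ↥(P ⊔ span k {e} ⊔ span k {f} ⊔ N j) ≤
          finrank k ↥(P ⊔ span k {e} ⊔ span k {f} ⊔ N j ⊔ span k {a}) := finrank_mono le_sup_left
      have g5 := (b' j).2.2.2.2.1 h
      have g6 := b' j
      have g7 := hq j
      rw [← ea P' (N' j) a'] at g1
      rw [← ea _ (N' j) a'] at g2
      rw [← ea P (N j) a] at g3
      rw [← ea _ (N j) a] at g4
      omega
    · rw [ea] at hu'j
      obtain ⟨m, hm, w, hw, hmw⟩ := mem_sup.1 hu'j
      obtain ⟨c, rfl⟩ := mem_span_singleton.1 hw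
      have hc : c ≠ 0 := by
        rintro rfl
        rw [zero_smul, add_zero] at hmw
        exact h (hmw ▸ hm)
      have : a' = c⁻¹ • (u' - m) := by rw [← hmw, add_sub_cancel_left, inv_smul_smul₀ hc]
      rw [this]
      exact smul_mem _ _ (sub_mem hu'l (mono1' hlt.le hm))
  have ha : a ∈ P ⊔ N l := by
    have g1 := finrank_sup_span_singleton_of_mem ha'
    have g2 := hpb l
    rw [ea, ea] at g2
    exact mem_of_finrank_sup_span_singleton_le (by omega)
  have hvj : v ∈ P ⊔ (N j ⊔ span k {a}) := hsv j (by omega)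
  have hle : P ⊔ (N j ⊔ span k {a}) ≤ P ⊔ N l :=
    sup_le le_sup_left (sup_le ((hN hlt.le).trans le_sup_right) (by simpa using ha))
  exact hvnot (hle hvj)

end Pencil

/-! ### Combinatorics of the ranks of two complete flags and a line. -/

section RankFunctions

/-- The numerical properties of the functions `dim (B_i + C_j)` and `dim (A + B_i + C_j)` for two
complete flags and a line in a space of dimension `n`. -/
structure IsRankPair (n : ℕ) (g h : ℕ → ℕ → ℕ) : Prop where
  row_le : ∀ i j, g i j ≤ g (i + 1) j
  le_row : ∀ i j, g (i + 1) j ≤ g i j + 1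
  col_le : ∀ i j, g i j ≤ g i (j + 1)
  le_col : ∀ i j, g i (j + 1) ≤ g i j + 1
  row_le' : ∀ i j, h i j ≤ h (i + 1) j
  le_row' : ∀ i j, h (i + 1) j ≤ h i j + 1
  col_le' : ∀ i j, h i j ≤ h i (j + 1)
  le_col' : ∀ i j, h i (j + 1) ≤ h i j + 1
  submod : ∀ {i i' j j'}, i ≤ i' → j ≤ j' → g i' j' + g i j ≤ g i' j + g i j'
  submod' : ∀ {i i' j j'}, i ≤ i' → j ≤ j' → h i' j' + h i j ≤ h i' j + h i j'
  le_bar : ∀ i j, g i j ≤ h i j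
  bar_le : ∀ i j, h i j ≤ g i j + 1
  bar_eq : ∀ {i i' j j'}, i ≤ i' → j ≤ j' → h i j = g i j → h i' j' = g i' j'
  row_zero : ∀ i ≤ n, g i 0 = i
  zero_col : ∀ j ≤ n, g 0 j = j
  col_top : ∀ i j, n ≤ j → g i j = n

/-- The `i + 1`-st row is as large as the neighbouring rows allow. -/
def IsGenericRow (g : ℕ → ℕ → ℕ) (i : ℕ) : Prop :=
  ∀ j, g (i + 1) j = min (g i j + 1) (g (i + 2) j)

theorem Nat.exists_crossing {Q : ℕ → Prop} {a b : ℕ} (hab : a ≤ b) (ha : Q a) (hb : ¬ Q b) :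
    ∃ c, a ≤ c ∧ c < b ∧ Q c ∧ ¬ Q (c + 1) := by
  by_contra hcon
  push Not at hcon
  have : ∀ c, a ≤ c → c ≤ b → Q c := by
    intro c hac
    induction c, hac using Nat.le_induction with
    | base => exact fun _ => ha
    | succ c hac ih => exact fun hcb => hcon c hac hcb (ih (by omega))
  exact hb (this b hab le_rfl)

namespace IsRankPair

variable {n : ℕ} {g h : ℕ → ℕ → ℕ}

theorem row_le_two (H : IsRankPair n g h) (i j : ℕ) :
    g (i + 1) j ≤ g (i + 2) j ∧ g (i + 2) j ≤ g (i + 1) j + 1 ∧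
      h (i + 1) j ≤ h (i + 2) j ∧ h (i + 2) j ≤ h (i + 1) j + 1 :=
  ⟨H.row_le _ _, H.le_row _ _, H.row_le' _ _, H.le_row' _ _⟩

theorem col_le_two (H : IsRankPair n g h) (i j : ℕ) :
    g i (j + 1) ≤ g i (j + 2) ∧ g i (j + 2) ≤ g i (j + 1) + 1 ∧
      h i (j + 1) ≤ h i (j + 2) ∧ h i (j + 2) ≤ h i (j + 1) + 1 :=
  ⟨H.col_le _ _, H.le_col _ _, H.col_le' _ _, H.le_col' _ _⟩

/-- Let `w i` be the first column at which rows `i` and `i + 1` of `g` agree; the claim is `w i < w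
(i + 1)`. At a descent, row `i + 1` of `g` is generic, so `h` must fail, and this forces the line
into `B_{i+1} + C_{j₀}` with `j₀ < w (i + 1)`. A column descent between the two values of `w` is
then generic for `g`, and for `h` too because the line has already been absorbed, contrary to
`hcol`. -/
theorem exists_ascent (H : IsRankPair n g h)
    (hrow : ∀ i, i + 2 ≤ n → ¬ (IsGenericRow g i ∧ IsGenericRow h i))
    (hcol : ∀ j, j + 2 ≤ n →
      ¬ (IsGenericRow (fun a b => g b a) j ∧ IsGenericRow (fun a b => h b a) j))
    (i : ℕ) (hi : i + 2 ≤ n) : ∃ j, g (i + 1) j = g i j ∧ g (i + 2) j = g (i + 1) j + 1 := by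
  by_contra hcon
  have hdesc : ∀ j, g (i + 1) j = g i j → g (i + 2) j = g (i + 1) j := by
    intro j hj
    by_contra hne
    have h1 := H.row_le_two i j
    exact hcon ⟨j, hj, by omega⟩
  have hg : IsGenericRow g i := by
    intro j
    have h1 := H.row_le_two i j
    have h3 := H.row_le i j
    have h4 := H.le_row i j
    have h5 := hdesc j
    omega
  have hh : ¬ IsGenericRow h i := fun hh => hrow i hi ⟨hg, hh⟩
  obtain ⟨j₀, hj₀⟩ := not_forall.1 hh
  change ¬ h (i + 1) j₀ = min (h i j₀ + 1) (h (i + 2) j₀) at hj₀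
  have r1 := H.row_le_two i j₀
  have r3 := H.row_le' i j₀
  have r4 := H.le_row' i j₀
  have r5 := H.le_row i j₀
  have r6 := H.row_le i j₀
  have r7 := H.le_bar i j₀
  have r8 := H.bar_le i j₀
  have r9 := H.le_bar (i + 1) j₀
  have r10 := H.bar_le (i + 1) j₀
  have r11 := H.le_bar (i + 2) j₀
  have r12 := H.bar_le (i + 2) j₀
  have r13 := hdesc j₀
  have r14 : h (i + 1) j₀ = g (i + 1) j₀ → h (i + 2) j₀ = g (i + 2) j₀ :=
    H.bar_eq (by omega) le_rfl
  -- A line outside at row `i + 1` is outside at row `i`; then `g` is flat from `i` to `i + 1`,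
  -- hence to `i + 2` by `hdesc`, and `h` could not rise as it does.
  have hbar : h (i + 1) j₀ = g (i + 1) j₀ := by omega
  have hstep : g (i + 2) j₀ = g (i + 1) j₀ + 1 := by omega
  have hj₀n : j₀ < n := by
    by_contra hle
    have h1 := H.col_top (i + 2) j₀ (by omega)
    have h2 := H.col_top (i + 1) j₀ (by omega)
    omega
  -- The columns `c₁ + 1` and `c₂ + 1` are `w (i + 1)` and `w i`. In row `i + 1` the column step
  -- from `c₁` raises the rank and the one from `c₂` does not, so a raising step is followed by a
  -- flat one in between.
  obtain ⟨c₁, hc₁, hc₁n, s1, s2⟩ := Nat.exists_crossing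
    (Q := fun j => g (i + 2) j = g (i + 1) j + 1) hj₀n.le hstep
    (by rw [H.col_top _ n le_rfl, H.col_top _ n le_rfl]; omega)
  have t1 : g (i + 1) (c₁ + 1) = g (i + 1) c₁ + 1 ∧ g (i + 1) (c₁ + 1) = g i (c₁ + 1) + 1 := by
    have h1 := H.row_le_two i (c₁ + 1)
    have h3 := H.col_le (i + 2) c₁
    have h4 := H.le_col (i + 1) c₁
    have h5 := hdesc c₁
    have h6 := H.row_le i c₁
    have h7 := H.le_row i c₁
    have h8 := H.row_le i (c₁ + 1)
    have h9 := H.le_row i (c₁ + 1)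
    have h10 := H.le_col i c₁
    omega
  obtain ⟨c₂, hc₂, hc₂n, s3, s4⟩ := Nat.exists_crossing
    (Q := fun j => g (i + 1) j = g i j + 1) (a := c₁ + 1) (b := n) (by omega) t1.2
    (by rw [H.col_top _ n le_rfl, H.col_top _ n le_rfl]; omega)
  have t2 : ¬ g (i + 1) (c₂ + 1) = g (i + 1) c₂ + 1 := by
    have h1 := H.row_le i (c₂ + 1)
    have h2 := H.le_row i (c₂ + 1)
    have h3 := H.le_col i c₂
    omega
  obtain ⟨c, hc, hcn, s5, s6⟩ := Nat.exists_crossing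
    (Q := fun j => g (i + 1) (j + 1) = g (i + 1) j + 1) (a := c₁) (b := c₂) (by omega) t1.1 t2
  change ¬ g (i + 1) (c + 2) = g (i + 1) (c + 1) + 1 at s6
  have s7 : g (i + 1) (c + 2) = g (i + 1) (c + 1) := by
    have h1 := H.col_le_two (i + 1) c
    omega
  -- Submodularity carries the raising step to the rows `l ≤ i + 1` and the flat step to the rows `l
  -- ≥ i + 1`; either one gives genericity.
  have hcg : IsGenericRow (fun a b => g b a) c := by
    intro l
    have h1 := H.col_le l c
    have h2 := H.le_col l c
    have h3 := H.col_le_two l c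
    change g l (c + 1) = min (g l c + 1) (g l (c + 2))
    rcases le_total l (i + 1) with hl | hl
    · have h5 := H.submod hl (j := c) (j' := c + 1) (by omega)
      omega
    · have h5 := H.submod hl (j := c + 1) (j' := c + 2) (by omega)
      omega
  have hch := fun hh => hcol c (by omega) ⟨hcg, hh⟩
  obtain ⟨l, hl⟩ := not_forall.1 hch
  change ¬ h l (c + 1) = min (h l c + 1) (h l (c + 2)) at hl
  have h1 := H.col_le' l c
  have h2 := H.le_col' l c
  have h3 := H.col_le_two l c
  have b1 := H.bar_eq (i := i + 1) (i' := i + 1) (j := j₀) (j' := c) le_rfl (by omega) hbar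
  have b2 := H.bar_eq (i := i + 1) (i' := i + 1) (j := j₀) (j' := c + 1) le_rfl (by omega) hbar
  -- For `l ≤ i + 1` the raising step of `h` in row `i + 1`, where `h` equals `g`, is carried over
  -- by submodularity; for `l ≥ i + 1` the two functions agree at the columns needed.
  rcases le_total l (i + 1) with hl' | hl'
  · have h5 := H.submod' hl' (j := c) (j' := c + 1) (by omega)
    omega
  · have h5 := H.submod hl' (j := c + 1) (j' := c + 2) (by omega)
    have b3 := H.bar_eq (i := i + 1) (i' := l) (j := j₀) (j' := c + 1) hl' (by omega) hbar
    have b4 := H.bar_eq (i := i + 1) (i' := l) (j := j₀) (j' := c + 2) hl' (by omega) hbar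
    omega

/-- If no row and no column is generic, the two flags coincide. -/
theorem eq_max (H : IsRankPair n g h)
    (hrow : ∀ i, i + 2 ≤ n → ¬ (IsGenericRow g i ∧ IsGenericRow h i))
    (hcol : ∀ j, j + 2 ≤ n →
      ¬ (IsGenericRow (fun a b => g b a) j ∧ IsGenericRow (fun a b => h b a) j))
    {i j : ℕ} (hi : i ≤ n) (hj : j ≤ n) : g i j = max i j := by
  have hasc := H.exists_ascent hrow hcol
  -- A permutation with only ascents is the identity. By induction the ascent column is beyond the
  -- previous row index, and submodularity moves the rise to all smaller columns.
  have up : ∀ i, i + 1 ≤ n → ∀ j ≤ i, g (i + 1) j = g i j + 1 := by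
    intro i
    induction i with
    | zero =>
      intro hn j hj
      obtain rfl : j = 0 := by omega
      rw [H.row_zero _ (by omega), H.row_zero _ (by omega)]
    | succ i ih =>
      intro hn j hj
      obtain ⟨l, hl, hl'⟩ := hasc i hn
      have hil : i < l := by
        by_contra hle
        have := ih (by omega) l (by omega)
        omega
      have h1 := H.submod (i := i + 1) (i' := i + 2) (j := j) (j' := l) (by omega) (by omega)
      have h2 := H.row_le_two i j
      change g (i + 2) j = g (i + 1) j + 1
      omega
  -- Here `d` counts rows from the top, so that the induction runs from row `n` downwards.
  have down : ∀ d i, i + 1 + d = n → ∀ j, i + 1 ≤ j → g (i + 1) j = g i j := by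
    intro d
    induction d with
    | zero =>
      intro i hn j hj
      rw [H.col_top _ j (by omega), H.col_top _ j (by omega)]
    | succ d ih =>
      intro i hn j hj
      obtain ⟨l, hl, hl'⟩ := hasc i (by omega)
      have hil : l ≤ i + 1 := by
        by_contra hle
        have : g (i + 2) l = g (i + 1) l := ih (i + 1) (by omega) l (by omega)
        omega
      have h1 := H.submod (i := i) (i' := i + 1) (j := l) (j' := j) (by omega) (by omega)
      have h2 := H.row_le i j
      omega
  have upper : ∀ i, i ≤ n → ∀ j, i ≤ j → j ≤ n → g i j = j := by
    intro i
    induction i with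
    | zero => exact fun _ j _ hj => H.zero_col j hj
    | succ i ih =>
      intro hi j hij hj
      rw [down (n - i - 1) i (by omega) j hij, ih (by omega) j (by omega) hj]
  have lower : ∀ j i, j ≤ i → i ≤ n → g i j = i := by
    intro j i hji
    induction i, hji using Nat.le_induction with
    | base => exact fun hj => upper j hj j le_rfl hj
    | succ i hji ih =>
      intro hi
      rw [up i hi j hji, ih (by omega)]
  rcases le_total i j with h | h
  · rw [upper i hi j h hj, max_eq_right h]
  · rw [lower j i h hi, max_eq_left h]

end IsRankPair

end RankFunctions

/-! ### Frames: vectors representing a line and two complete flags. -/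

section Frames

open Submodule Module

variable {k V : Type*} [Field k] [AddCommGroup V] [Module k V]

/-- The span of the first `t` terms of a sequence of vectors. -/
def initSpan (k : Type*) {V : Type*} [Field k] [AddCommGroup V] [Module k V] (β : ℕ → V) (t : ℕ) :
    Submodule k V :=
  span k (β '' Set.Iio t)

theorem initSpan_mono (β : ℕ → V) : Monotone (initSpan k β) :=
  fun _ _ h => span_mono (Set.image_mono (Set.Iio_subset_Iio h))

theorem initSpan_zero (β : ℕ → V) : initSpan k β 0 = ⊥ := by
  simp [initSpan]

theorem initSpan_succ (β : ℕ → V) (t : ℕ) :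
    initSpan k β (t + 1) = initSpan k β t ⊔ span k {β t} := by
  rw [initSpan, initSpan, ← span_union, ← Set.image_singleton, ← Set.image_union]
  congr 2
  ext x
  simp only [Set.mem_Iio, Set.mem_union, Set.mem_singleton_iff]
  omega

theorem mem_initSpan (β : ℕ → V) {s t : ℕ} (h : s < t) : β s ∈ initSpan k β t :=
  subset_span ⟨s, h, rfl⟩

theorem initSpan_congr {β β' : ℕ → V} {t : ℕ} (h : ∀ s < t, β s = β' s) :
    initSpan k β t = initSpan k β' t := by
  have : β '' Set.Iio t = β' '' Set.Iio t := Set.image_congr h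
  rw [initSpan, initSpan, this]

theorem initSpan_eq_top {β : ℕ → V} {n t : ℕ} (h : initSpan k β n = ⊤) (hnt : n ≤ t) :
    initSpan k β t = ⊤ :=
  top_le_iff.1 (h ▸ initSpan_mono β hnt)

theorem initSpan_min {β : ℕ → V} {n : ℕ} (h : initSpan k β n = ⊤) (t : ℕ) :
    initSpan k β t = initSpan k β (min t n) := by
  rcases le_total t n with hle | hle
  · rw [min_eq_left hle]
  · rw [min_eq_right hle, h, initSpan_eq_top h hle]

section FiniteDimensional

variable [FiniteDimensional k V]

theorem finrank_initSpan_le (β : ℕ → V) (t : ℕ) : finrank k ↥(initSpan k β t) ≤ t := by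
  induction t with
  | zero => rw [initSpan_zero, finrank_bot]
  | succ t ih =>
    rw [initSpan_succ]
    have := finrank_sup_span_singleton_le (initSpan k β t) (β t)
    omega

theorem finrank_initSpan {β : ℕ → V} {n : ℕ} (hn : finrank k V = n) (h : initSpan k β n = ⊤)
    {t : ℕ} (ht : t ≤ n) : finrank k ↥(initSpan k β t) = t := by
  have key : ∀ s, finrank k ↥(initSpan k β (t + s)) ≤ finrank k ↥(initSpan k β t) + s := by
    intro s
    induction s with
    | zero => simp
    | succ s ih =>
      rw [← add_assoc, initSpan_succ]
      have := finrank_sup_span_singleton_le (initSpan k β (t + s)) (β (t + s))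
      omega
  have h1 := key (n - t)
  rw [Nat.add_sub_cancel' ht, h, finrank_top, hn] at h1
  have h2 := finrank_initSpan_le (k := k) β t
  omega

end FiniteDimensional

/-- A vector together with two sequences of vectors. -/
abbrev FrameTriple (V : Type*) : Type _ := V × (ℕ → V) × (ℕ → V)

/-- `dim (B_i + C_j)`. -/
noncomputable def frameRank (k : Type*) {V : Type*} [Field k] [AddCommGroup V] [Module k V]
    (y : FrameTriple V) (i j : ℕ) : ℕ :=
  finrank k ↥(initSpan k y.2.1 i ⊔ initSpan k y.2.2 j)

/-- `dim (A + B_i + C_j)`. -/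
noncomputable def frameRankBar (k : Type*) {V : Type*} [Field k] [AddCommGroup V] [Module k V]
    (y : FrameTriple V) (i j : ℕ) : ℕ :=
  finrank k ↥(initSpan k y.2.1 i ⊔ (initSpan k y.2.2 j ⊔ span k {y.1}))

/-- The vector is nonzero and the first `n` terms of the two sequences span. -/
structure IsFramed (k : Type*) {V : Type*} [Field k] [AddCommGroup V] [Module k V] (n : ℕ)
    (y : FrameTriple V) : Prop where
  ne_zero : y.1 ≠ 0
  fst : initSpan k y.2.1 n = ⊤
  snd : initSpan k y.2.2 n = ⊤

/-- The triples with the same ranks as `y`. -/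
def rankCell (k : Type*) {V : Type*} [Field k] [AddCommGroup V] [Module k V] (n : ℕ)
    (y : FrameTriple V) : Set (FrameTriple V) :=
  {z | IsFramed k n z ∧
    ∀ i j, frameRank k z i j = frameRank k y i j ∧ frameRankBar k z i j = frameRankBar k y i j}

/-- Exchange the two sequences of vectors. -/
def frameSwap (k : Type*) {V : Type*} [Field k] [AddCommGroup V] [Module k V] :
    FrameTriple V →ₗ[k] FrameTriple V where
  toFun y := (y.1, y.2.2, y.2.1)
  map_add' _ _ := rfl
  map_smul' _ _ := rfl

theorem frameRank_swap (y : FrameTriple V) (i j : ℕ) :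
    frameRank k (frameSwap k y) i j = frameRank k y j i := by
  rw [frameRank, frameRank, sup_comm]
  rfl

theorem frameRankBar_swap (y : FrameTriple V) (i j : ℕ) :
    frameRankBar k (frameSwap k y) i j = frameRankBar k y j i := by
  rw [frameRankBar, frameRankBar, sup_left_comm]
  rfl

theorem IsFramed.swap {n : ℕ} {y : FrameTriple V} (h : IsFramed k n y) :
    IsFramed k n (frameSwap k y) :=
  ⟨h.ne_zero, h.snd, h.fst⟩

theorem swap_mem_rankCell {n : ℕ} {y z : FrameTriple V} (h : z ∈ rankCell k n y) :
    frameSwap k z ∈ rankCell k n (frameSwap k y) :=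
  ⟨h.1.swap, fun i j => by
    rw [frameRank_swap, frameRank_swap, frameRankBar_swap, frameRankBar_swap]; exact h.2 j i⟩

/-- The sequences are infinite, but their spans are stationary from index `n` on, so finitely many
ranks determine all of them. -/
theorem frameRank_min {n : ℕ} {y : FrameTriple V} (h : IsFramed k n y) (i j : ℕ) :
    frameRank k y i j = frameRank k y (min i n) (min j n) ∧
      frameRankBar k y i j = frameRankBar k y (min i n) (min j n) := by
  simp only [frameRank, frameRankBar]
  rw [← initSpan_min h.fst, ← initSpan_min h.snd]
  exact ⟨rfl, rfl⟩

theorem mem_rankCell_iff {n : ℕ} {y z : FrameTriple V}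
    (hy : IsFramed k n y) (hz : IsFramed k n z) :
    z ∈ rankCell k n y ↔ ∀ i ≤ n, ∀ j ≤ n,
      frameRank k z i j = frameRank k y i j ∧ frameRankBar k z i j = frameRankBar k y i j := by
  refine ⟨fun h i _ j _ => h.2 i j, fun h => ⟨hz, fun i j => ?_⟩⟩
  rw [(frameRank_min hz i j).1, (frameRank_min hz i j).2, (frameRank_min hy i j).1,
    (frameRank_min hy i j).2]
  exact h _ (min_le_right _ _) _ (min_le_right _ _)

/-- Replace the terms `β i`, `β (i + 1)` by two linear combinations of them. -/
def mixFrame (k : Type*) {V : Type*} [Field k] [AddCommGroup V] [Module k V] (i : ℕ)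
    (s t s' t' : k) : FrameTriple V →ₗ[k] FrameTriple V where
  toFun y := (y.1, fun l => if l = i then s • y.2.1 i + t • y.2.1 (i + 1) else
    if l = i + 1 then s' • y.2.1 i + t' • y.2.1 (i + 1) else y.2.1 l, y.2.2)
  map_add' x y := by
    ext l
    · rfl
    · simp only [Prod.snd_add, Prod.fst_add, Pi.add_apply]
      split_ifs <;> module
    · rfl
  map_smul' c y := by
    ext l
    · rfl
    · simp only [Prod.smul_snd, Prod.smul_fst, Pi.smul_apply, RingHom.id_apply]
      split_ifs <;> module
    · rfl

/-- The coefficients are those of the inverse of the `2 × 2` matrix with rows `(s, t)` and `(s',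
t')`. -/
theorem mixFrame_mixFrame (i : ℕ) {s t s' t' : k} (hd : s * t' - t * s' ≠ 0) (y : FrameTriple V) :
    mixFrame k i (t' / (s * t' - t * s')) (-t / (s * t' - t * s')) (-s' / (s * t' - t * s'))
      (s / (s * t' - t * s')) (mixFrame k i s t s' t' y) = y := by
  have hc := inv_mul_cancel₀ hd
  simp only [div_eq_mul_inv]
  generalize (s * t' - t * s')⁻¹ = c at hc
  ext l
  · rfl
  · simp only [mixFrame, LinearMap.coe_mk, AddHom.coe_mk, if_true, Nat.succ_ne_self, if_false]
    split_ifs with h h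
    · subst h
      match_scalars <;> first | linear_combination hc | ring
    · subst h
      match_scalars <;> first | linear_combination hc | ring
    · rfl
  · rfl

/-- Only the initial segment of length `i + 1` separates the terms `i` and `i + 1`. -/
theorem initSpan_mixFrame_le (i : ℕ) (s t s' t' : k) (y : FrameTriple V) {l : ℕ}
    (hl : l ≠ i + 1) :
    initSpan k (mixFrame k i s t s' t' y).2.1 l ≤ initSpan k y.2.1 l := by
  refine span_le.2 ?_
  rintro _ ⟨m, hm, rfl⟩
  have hm' : m < l := hm
  have h1 : ∀ {m}, m < l → y.2.1 m ∈ initSpan k y.2.1 l := fun h => mem_initSpan _ h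
  change (if m = i then s • y.2.1 i + t • y.2.1 (i + 1) else
    if m = i + 1 then s' • y.2.1 i + t' • y.2.1 (i + 1) else y.2.1 m) ∈ initSpan k y.2.1 l
  split_ifs with h h
  · exact add_mem (smul_mem _ _ (h1 (by omega))) (smul_mem _ _ (h1 (by omega)))
  · exact add_mem (smul_mem _ _ (h1 (by omega))) (smul_mem _ _ (h1 (by omega)))
  · exact h1 hm'

theorem initSpan_mixFrame (i : ℕ) {s t s' t' : k} (hd : s * t' - t * s' ≠ 0) (y : FrameTriple V)
    {l : ℕ} (hl : l ≠ i + 1) :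
    initSpan k (mixFrame k i s t s' t' y).2.1 l = initSpan k y.2.1 l := by
  refine le_antisymm (initSpan_mixFrame_le _ _ _ _ _ _ hl) ?_
  conv_lhs => rw [← mixFrame_mixFrame i hd y]
  exact initSpan_mixFrame_le _ _ _ _ _ _ hl

theorem initSpan_mixFrame_succ (i : ℕ) (s t s' t' : k) (y : FrameTriple V) :
    initSpan k (mixFrame k i s t s' t' y).2.1 (i + 1) =
      initSpan k y.2.1 i ⊔ span k {s • y.2.1 i + t • y.2.1 (i + 1)} := by
  rw [initSpan_succ]
  congr 1
  · refine initSpan_congr fun m hm => ?_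
    have h1 : m ≠ i + 1 := by omega
    simp [mixFrame, hm.ne, h1]
  · simp [mixFrame]

theorem IsFramed.mix {n i : ℕ} (hi : i + 2 ≤ n) {s t s' t' : k} (hd : s * t' - t * s' ≠ 0)
    {y : FrameTriple V} (hy : IsFramed k n y) : IsFramed k n (mixFrame k i s t s' t' y) :=
  ⟨hy.ne_zero, (initSpan_mixFrame i hd y (by omega)).trans hy.fst, hy.snd⟩

theorem frameRank_mix (i : ℕ) {s t s' t' : k} (hd : s * t' - t * s' ≠ 0)
    (y : FrameTriple V) {l : ℕ} (hl : l ≠ i + 1) (j : ℕ) :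
    frameRank k (mixFrame k i s t s' t' y) l j = frameRank k y l j ∧
      frameRankBar k (mixFrame k i s t s' t' y) l j = frameRankBar k y l j := by
  simp only [frameRank, frameRankBar]
  rw [initSpan_mixFrame i hd y hl]
  exact ⟨rfl, rfl⟩

variable [FiniteDimensional k V]

theorem isRankPair {n : ℕ} (hn : finrank k V = n) {y : FrameTriple V} (hy : IsFramed k n y) :
    IsRankPair n (frameRank k y) (frameRankBar k y) := by
  have mono : ∀ (P P' N N' : Submodule k V), P ≤ P' → N ≤ N' →
      finrank k ↥(P ⊔ N) ≤ finrank k ↥(P' ⊔ N') := fun _ _ _ _ h h' =>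
    finrank_mono (sup_le_sup h h')
  have step : ∀ (P N : Submodule k V) (e : V),
      finrank k ↥(P ⊔ span k {e} ⊔ N) ≤ finrank k ↥(P ⊔ N) + 1 := fun P N e => by
    rw [sup_right_comm]; exact finrank_sup_span_singleton_le _ _
  have step' : ∀ (P N : Submodule k V) (e : V),
      finrank k ↥(P ⊔ (N ⊔ span k {e})) ≤ finrank k ↥(P ⊔ N) + 1 := fun P N e => by
    rw [← sup_assoc]; exact finrank_sup_span_singleton_le _ _
  -- Submodularity: `P' ⊔ N` and `P ⊔ N'` together span `P' ⊔ N'`, and their intersection contains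
  -- `P ⊔ N`.
  have sub : ∀ {P P' N N' : Submodule k V}, P ≤ P' → N ≤ N' →
      finrank k ↥(P' ⊔ N') + finrank k ↥(P ⊔ N) ≤ finrank k ↥(P' ⊔ N) + finrank k ↥(P ⊔ N') := by
    intro P P' N N' h h'
    rw [← finrank_sup_add_finrank_inf_eq (P' ⊔ N) (P ⊔ N')]
    refine add_le_add (finrank_mono ?_) (finrank_mono ?_)
    · exact sup_le (le_sup_left.trans le_sup_left) (le_sup_right.trans le_sup_right)
    · exact le_inf (sup_le_sup h le_rfl) (sup_le_sup le_rfl h')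
  have mB := initSpan_mono (k := k) y.2.1
  have mC := initSpan_mono (k := k) y.2.2
  have mC' : Monotone fun j => initSpan k y.2.2 j ⊔ span k {y.1} :=
    fun _ _ h => sup_le_sup_right (mC h) _
  refine
    { row_le := fun i j => mono _ _ _ _ (mB (Nat.le_succ i)) le_rfl
      le_row := fun i j => ?_
      col_le := fun i j => mono _ _ _ _ le_rfl (mC (Nat.le_succ j))
      le_col := fun i j => ?_
      row_le' := fun i j => mono _ _ _ _ (mB (Nat.le_succ i)) le_rfl
      le_row' := fun i j => ?_
      col_le' := fun i j => mono _ _ _ _ le_rfl (mC' (Nat.le_succ j))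
      le_col' := fun i j => ?_
      submod := fun h h' => sub (mB h) (mC h')
      submod' := fun h h' => sub (mB h) (mC' h')
      le_bar := fun i j => mono _ _ _ _ le_rfl le_sup_left
      bar_le := fun i j => step' _ _ _
      bar_eq := fun {i i' j j'} h h' e => ?_
      row_zero := fun i hi => ?_
      zero_col := fun j hj => ?_
      col_top := fun i j hj => ?_ }
  · rw [frameRank, initSpan_succ]; exact step _ _ _
  · rw [frameRank, initSpan_succ]; exact step' _ _ _
  · rw [frameRankBar, initSpan_succ]; exact step _ _ _
  · rw [frameRankBar, initSpan_succ, sup_right_comm]; exact step' _ _ _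
  · rw [frameRank, frameRankBar, ← sup_assoc] at *
    have := mem_of_finrank_sup_span_singleton_le e.le
    exact finrank_sup_span_singleton_of_mem (sup_le_sup (mB h) (mC h') this)
  · rw [frameRank, initSpan_zero, sup_bot_eq, finrank_initSpan hn hy.fst hi]
  · rw [frameRank, initSpan_zero, bot_sup_eq, finrank_initSpan hn hy.snd hj]
  · rw [frameRank, initSpan_eq_top hy.snd hj, sup_top_eq, finrank_top, hn]

/-- If row `i + 1` of the ranks of `y` is generic, then the closure of the triples with the ranks of
`y` contains the triples that have the ranks of `y` except in this row. -/
theorem mem_polyHull_of_isGenericRow [Infinite k] {n i : ℕ} (hi : i + 2 ≤ n) {y z : FrameTriple V}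
    (hy : IsFramed k n y) (hz : IsFramed k n z)
    (hyz : ∀ l, l ≠ i + 1 → ∀ j, frameRank k z l j = frameRank k y l j ∧
      frameRankBar k z l j = frameRankBar k y l j)
    (hg : IsGenericRow (frameRank k y) i) (hg' : IsGenericRow (frameRankBar k y) i) :
    z ∈ polyHull k (rankCell k n y) := by
  set P := initSpan k z.2.1 i with hP
  set e := z.2.1 i with he
  set f := z.2.1 (i + 1) with hf
  have hQ : initSpan k z.2.1 (i + 2) = P ⊔ span k {e} ⊔ span k {f} := by
    rw [initSpan_succ, initSpan_succ]
  -- Two different parameters in this set would put `f`, and then `e`, into `P ⊔ N`; so at most one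
  -- parameter is bad for each `N`.
  let bad : Submodule k V → Set k := fun N =>
    {τ | e + τ • f ∈ P ⊔ N ∧ ¬ P ⊔ span k {e} ⊔ span k {f} ≤ P ⊔ N}
  have hbad : ∀ N, (bad N).Finite := by
    intro N
    refine Set.Subsingleton.finite ?_
    rintro τ ⟨h1, h2⟩ τ' ⟨h1', -⟩
    by_contra hne
    have h3 : (τ - τ') • f ∈ P ⊔ N := by
      have := sub_mem h1 h1'
      rwa [add_sub_add_left_eq_sub, ← sub_smul] at this
    have h4 : f ∈ P ⊔ N := ((P ⊔ N).smul_mem_iff (sub_ne_zero.2 hne)).1 h3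
    have h5 : e ∈ P ⊔ N := by
      have := sub_mem h1 (smul_mem _ τ h4)
      rwa [add_sub_cancel_right] at this
    exact h2 (sup_le (sup_le le_sup_left (by simpa using h5)) (by simpa using h4))
  have hgen : ∀ N τ, τ ∉ bad N → finrank k ↥(P ⊔ span k {e + τ • f} ⊔ N) =
      min (finrank k ↥(P ⊔ N) + 1) (finrank k ↥(P ⊔ span k {e} ⊔ span k {f} ⊔ N)) := by
    intro N τ hτ
    have hb := pencil_bounds P N (e := e) (f := f) (u := e + τ • f) (s := 1) (t := τ)
      (Or.inl one_ne_zero) (by rw [one_smul])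
    by_cases h : e + τ • f ∈ P ⊔ N
    · have h1 : P ⊔ span k {e} ⊔ span k {f} ≤ P ⊔ N := by
        by_contra h2
        exact hτ ⟨h, h2⟩
      have h2 : finrank k ↥(P ⊔ span k {e} ⊔ span k {f} ⊔ N) ≤ finrank k ↥(P ⊔ N) :=
        finrank_mono (sup_le h1 le_sup_right)
      have := hb.2.2.2.2.1 h
      omega
    · have := mt hb.2.2.2.2.2 h
      omega
  -- Adding multiples of `f` to the `i`-th vector moves only the space of index `i + 1`, through the
  -- pencil. All but finitely many parameters make it generic, and then its ranks are those of `y`.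
  refine mem_polyHull_of_line (k := k) z (0, Pi.single i f, 0)
    (bad := ⋃ j ∈ Set.Iic n, bad (initSpan k z.2.2 j) ∪ bad (initSpan k z.2.2 j ⊔ span k {z.1}))
    ((Set.finite_Iic n).biUnion fun j _ => (hbad _).union (hbad _)) ?_
  intro τ hτ
  simp only [Set.mem_iUnion, not_exists, Set.mem_union, not_or, Set.mem_Iic] at hτ
  have hd : (1 : k) * 1 - τ * 0 ≠ 0 := by simp
  have hcurve : z + τ • ((0, Pi.single i f, 0) : FrameTriple V) = mixFrame k i 1 τ 0 1 z := by
    ext l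
    · simp [mixFrame]
    · by_cases h1 : l = i
      · subst h1; simp [mixFrame, hf]
      · by_cases h2 : l = i + 1
        · subst h2; simp [mixFrame]
        · simp [mixFrame, h1, h2]
    · simp [mixFrame]
  rw [hcurve, mem_rankCell_iff hy (hz.mix hi hd)]
  intro l _ j hj
  by_cases hl : l = i + 1
  · subst hl
    have h1 : frameRank k (mixFrame k i 1 τ 0 1 z) (i + 1) j =
        finrank k ↥(P ⊔ span k {e + τ • f} ⊔ initSpan k z.2.2 j) := by
      rw [frameRank, initSpan_mixFrame_succ, one_smul]; rfl
    have h2 : frameRankBar k (mixFrame k i 1 τ 0 1 z) (i + 1) j =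
        finrank k ↥(P ⊔ span k {e + τ • f} ⊔ (initSpan k z.2.2 j ⊔ span k {z.1})) := by
      rw [frameRankBar, initSpan_mixFrame_succ, one_smul]; rfl
    rw [h1, h2, hgen _ _ (hτ j hj).1, hgen _ _ (hτ j hj).2, hg j, hg' j,
      ← (hyz i (by omega) j).1, ← (hyz i (by omega) j).2, ← (hyz (i + 2) (by omega) j).1,
      ← (hyz (i + 2) (by omega) j).2, frameRank, frameRank, frameRankBar, frameRankBar, hQ]
    exact ⟨rfl, rfl⟩
  · rw [(frameRank_mix i hd z hl j).1, (frameRank_mix i hd z hl j).2]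
    exact hyz l hl j

end Frames

/-! ### The closure of a rank cell for complete flags. -/

section FullFlags

open Submodule Module

variable {k V : Type*} [Field k] [AddCommGroup V] [Module k V]

theorem exists_mixFrame_leftInverse (i : ℕ) {s t s' t' : k} (hd : s * t' - t * s' ≠ 0) :
    ∃ p q p' q' : k, p * q' - q * p' ≠ 0 ∧
      ∀ y : FrameTriple V, mixFrame k i p q p' q' (mixFrame k i s t s' t' y) = y := by
  refine ⟨_, _, _, _, ?_, mixFrame_mixFrame i hd⟩
  have : t' / (s * t' - t * s') * (s / (s * t' - t * s')) -
      -t / (s * t' - t * s') * (-s' / (s * t' - t * s')) =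
      (s * t' - t * s') / ((s * t' - t * s') * (s * t' - t * s')) := by
    rw [div_mul_div_comm, div_mul_div_comm, ← sub_div]
    ring
  rw [this]
  exact div_ne_zero hd (mul_ne_zero hd hd)

theorem exists_complementary_row {s t : k} (h : s ≠ 0 ∨ t ≠ 0) :
    ∃ s' t' : k, s * t' - t * s' ≠ 0 := by
  rcases h with h | h
  · exact ⟨0, 1, by simpa using h⟩
  · exact ⟨1, 0, by simpa using h⟩

/-- The total of all ranks. -/
noncomputable def totalRank (k : Type*) {V : Type*} [Field k] [AddCommGroup V] [Module k V] (n : ℕ)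
    (y : FrameTriple V) : ℕ :=
  ∑ i ∈ Finset.range (n + 1), ∑ j ∈ Finset.range (n + 1), (frameRank k y i j + frameRankBar k y i j)

theorem totalRank_swap (n : ℕ) (y : FrameTriple V) :
    totalRank k n (frameSwap k y) = totalRank k n y := by
  rw [totalRank, totalRank, Finset.sum_comm]
  simp only [frameRank_swap, frameRankBar_swap]

theorem totalRank_lt {n i j : ℕ} (hi : i ≤ n) (hj : j ≤ n) {y y' : FrameTriple V}
    (h : ∀ i j, frameRank k y i j ≤ frameRank k y' i j ∧
      frameRankBar k y i j ≤ frameRankBar k y' i j)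
    (hlt : frameRank k y i j < frameRank k y' i j) : totalRank k n y < totalRank k n y' := by
  refine Finset.sum_lt_sum (fun a _ => Finset.sum_le_sum fun b _ => add_le_add (h a b).1 (h a b).2)
    ⟨i, Finset.mem_range.2 (by omega), ?_⟩
  exact Finset.sum_lt_sum (fun b _ => add_le_add (h i b).1 (h i b).2)
    ⟨j, Finset.mem_range.2 (by omega), add_lt_add_of_lt_of_le hlt (h i j).2⟩

variable [FiniteDimensional k V]

/-- Specializing both pencils gives `z ≤ z'` with `z'` strictly below `y'`, so `ih` makes `z` a
limit of the cell of `z'`. The linear map that turns `z` back into `y` sends this cell to frames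
with the ranks of `y'` outside row `i + 1`; these are limits of the cell of `y'` since that row is
generic. -/
theorem mem_polyHull_of_generic_step [Infinite k] {n : ℕ} (hn : finrank k V = n)
    {y y' : FrameTriple V} (hy : IsFramed k n y) (hy' : IsFramed k n y')
    (hle : ∀ i j, frameRank k y i j ≤ frameRank k y' i j ∧
      frameRankBar k y i j ≤ frameRankBar k y' i j)
    (ih : ∀ z' : FrameTriple V, IsFramed k n z' → totalRank k n z' < totalRank k n y' →
      ∀ z : FrameTriple V, IsFramed k n z → (∀ i j, frameRank k z i j ≤ frameRank k z' i j ∧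
        frameRankBar k z i j ≤ frameRankBar k z' i j) → z ∈ polyHull k (rankCell k n z'))
    {i : ℕ} (hi : i + 2 ≤ n) (hg : IsGenericRow (frameRank k y') i)
    (hg' : IsGenericRow (frameRankBar k y') i) : y ∈ polyHull k (rankCell k n y') := by
  have hQ : ∀ β : ℕ → V, initSpan k β (i + 2) =
      initSpan k β i ⊔ span k {β i} ⊔ span k {β (i + 1)} := fun β => by
    rw [initSpan_succ, initSpan_succ]
  obtain ⟨u, u', s, t, s', t', hst, hst', hu, hu', hs', c1, c2⟩ := exists_lift
    (initSpan k y.2.1 i) (initSpan k y'.2.1 i) (y.2.1 i) (y.2.1 (i + 1)) (y'.2.1 i)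
    (y'.2.1 (i + 1)) y.1 y'.1 (initSpan k y.2.2) (initSpan k y'.2.2) (initSpan_mono _)
    (initSpan_mono _) n hy.snd hy'.snd (fun j => (hle i j).1)
    (fun j => by rw [← hQ, ← hQ]; exact (hle (i + 2) j).1) (fun j => (hle i j).2)
    (fun j => by rw [← hQ, ← hQ]; exact (hle (i + 2) j).2)
  obtain ⟨p, q, hd⟩ := exists_complementary_row hst
  obtain ⟨p', q', hd'⟩ := exists_complementary_row hst'
  set z := mixFrame k i s t p q y with hz
  set z' := mixFrame k i s' t' p' q' y' with hz'
  have rz : ∀ j, frameRank k z (i + 1) j =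
        finrank k ↥(initSpan k y.2.1 i ⊔ span k {u} ⊔ initSpan k y.2.2 j) ∧
      frameRankBar k z (i + 1) j = finrank k
        ↥(initSpan k y.2.1 i ⊔ span k {u} ⊔ (initSpan k y.2.2 j ⊔ span k {y.1})) := by
    intro j
    rw [frameRank, frameRankBar, hz, initSpan_mixFrame_succ, ← hu]
    exact ⟨rfl, rfl⟩
  have rz' : ∀ j, frameRank k z' (i + 1) j =
        finrank k ↥(initSpan k y'.2.1 i ⊔ span k {u'} ⊔ initSpan k y'.2.2 j) ∧
      frameRankBar k z' (i + 1) j = finrank k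
        ↥(initSpan k y'.2.1 i ⊔ span k {u'} ⊔ (initSpan k y'.2.2 j ⊔ span k {y'.1})) := by
    intro j
    rw [frameRank, frameRankBar, hz', initSpan_mixFrame_succ, ← hu']
    exact ⟨rfl, rfl⟩
  have hzz' : ∀ l j, frameRank k z l j ≤ frameRank k z' l j ∧
      frameRankBar k z l j ≤ frameRankBar k z' l j := by
    intro l j
    by_cases hl : l = i + 1
    · subst hl
      rw [(rz j).1, (rz j).2, (rz' j).1, (rz' j).2]
      exact ⟨c1 j, c2 j⟩
    · rw [(frameRank_mix i hd y hl j).1, (frameRank_mix i hd y hl j).2,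
        (frameRank_mix i hd' y' hl j).1, (frameRank_mix i hd' y' hl j).2]
      exact hle l j
  have hz'y' : ∀ l j, frameRank k z' l j ≤ frameRank k y' l j ∧
      frameRankBar k z' l j ≤ frameRankBar k y' l j := by
    intro l j
    by_cases hl : l = i + 1
    · subst hl
      have b1 := pencil_bounds (initSpan k y'.2.1 i) (initSpan k y'.2.2 j) hst' hu'
      have b2 := pencil_bounds (initSpan k y'.2.1 i) (initSpan k y'.2.2 j ⊔ span k {y'.1}) hst' hu'
      rw [← hQ] at b1 b2
      rw [(rz' j).1, (rz' j).2, hg j, hg' j]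
      exact ⟨le_min b1.2.1 b1.2.2.1, le_min b2.2.1 b2.2.2.1⟩
    · rw [(frameRank_mix i hd' y' hl j).1, (frameRank_mix i hd' y' hl j).2]
      exact ⟨le_rfl, le_rfl⟩
  have H := isRankPair hn hy'
  -- Modulo `B_i + C_j` the pencil has dimension two for `j = 0` and zero for `j = n`. At `c + 1` it
  -- has dimension one: there the generic member raises the rank and the special member does not, so
  -- the total rank drops.
  obtain ⟨c, -, hcn, h1, h2⟩ := Nat.exists_crossing
    (Q := fun j => frameRank k y' (i + 2) j = frameRank k y' i j + 2) (Nat.zero_le n)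
    (by rw [H.row_zero _ hi, H.row_zero _ (by omega)])
    (by rw [H.col_top _ n le_rfl, H.col_top _ n le_rfl]; omega)
  have hlt : frameRank k z' (i + 1) (c + 1) < frameRank k y' (i + 1) (c + 1) := by
    have e1 := H.le_col i c
    have e2 := H.col_le (i + 2) c
    have e3 := H.le_row i (c + 1)
    have e4 := H.row_le_two i (c + 1)
    have b1 := (pencil_bounds (initSpan k y'.2.1 i) (initSpan k y'.2.2 (c + 1)) hst' hu').2.2.2.2.1
      (hs' (c + 1) (by
        rw [← hQ]
        change frameRank k y' (i + 2) (c + 1) ≤ frameRank k y' i (c + 1) + 1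
        omega))
    rw [(rz' _).1, hg, b1]
    change frameRank k y' i (c + 1) < _
    omega
  have hfz := hy.mix hi hd
  have hfz' := hy'.mix hi hd'
  have hmem := ih z' hfz' (totalRank_lt (by omega) (by omega) hz'y' hlt) z hfz hzz'
  obtain ⟨r₁, r₂, r₃, r₄, hr, hinv⟩ := exists_mixFrame_leftInverse (V := V) i hd
  rw [← hinv y]
  refine map_mem_polyHull _ (fun w hw => ?_) hmem
  refine mem_polyHull_of_isGenericRow hi hy' (hw.1.mix hi hr) (fun l hl j => ?_) hg hg'
  rw [(frameRank_mix i hr w hl j).1, (frameRank_mix i hr w hl j).2, (hw.2 l j).1, (hw.2 l j).2]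
  exact frameRank_mix i hd' y' hl j

/-- The inequalities force the two flags of `y` to coincide as well. What remains is the first index
`m + 1` at which the flag of `y'` contains its vector. The vector of `y` lies in the corresponding
space, and adding a multiple of the `m`-th frame vector takes it out of the preceding one. -/
theorem mem_polyHull_of_eq_max [Infinite k] {n : ℕ} (hn : finrank k V = n)
    {y y' : FrameTriple V} (hy : IsFramed k n y) (hy' : IsFramed k n y')
    (hle : ∀ i j, frameRank k y i j ≤ frameRank k y' i j ∧
      frameRankBar k y i j ≤ frameRankBar k y' i j)
    (hmax : ∀ i j, i ≤ n → j ≤ n → frameRank k y' i j = max i j) :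
    y ∈ polyHull k (rankCell k n y') := by
  classical
  have same : ∀ z : FrameTriple V, IsFramed k n z →
      (∀ i j, frameRank k z i j ≤ frameRank k y' i j) →
      ∀ i ≤ n, ∀ j ≤ n, initSpan k z.2.1 i ⊔ initSpan k z.2.2 j = initSpan k z.2.1 (max i j) := by
    intro z hz h i hi j hj
    have e : ∀ t ≤ n, initSpan k z.2.2 t = initSpan k z.2.1 t := by
      intro t ht
      have h1 := h t t
      rw [hmax t t ht ht, max_self] at h1
      have h2 : initSpan k z.2.1 t = initSpan k z.2.1 t ⊔ initSpan k z.2.2 t :=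
        eq_of_le_of_finrank_le le_sup_left (h1.trans (finrank_initSpan hn hz.fst ht).ge)
      have h3 : initSpan k z.2.2 t = initSpan k z.2.1 t ⊔ initSpan k z.2.2 t :=
        eq_of_le_of_finrank_le le_sup_right (h1.trans (finrank_initSpan hn hz.snd ht).ge)
      exact h3.trans h2.symm
    rw [e j hj]
    rcases le_total i j with h | h
    · rw [max_eq_right h, sup_eq_right.2 (initSpan_mono _ h)]
    · rw [max_eq_left h, sup_eq_left.2 (initSpan_mono _ h)]
  have bar : ∀ z : FrameTriple V, IsFramed k n z →
      (∀ i j, frameRank k z i j ≤ frameRank k y' i j) → ∀ i ≤ n, ∀ j ≤ n,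
      frameRank k z i j = max i j ∧
      frameRankBar k z i j = max i j + if z.1 ∈ initSpan k z.2.1 (max i j) then 0 else 1 := by
    intro z hz h i hi j hj
    have hf := finrank_initSpan hn hz.fst (max_le hi hj)
    rw [frameRank, frameRankBar, ← sup_assoc, same z hz h i hi j hj]
    refine ⟨hf, ?_⟩
    split_ifs with hmem
    · rw [finrank_sup_span_singleton_of_mem hmem, hf, add_zero]
    · rw [finrank_sup_span_singleton_of_notMem hmem, hf]
  have hex : ∃ m, y'.1 ∈ initSpan k y'.2.1 m := ⟨n, by rw [hy'.fst]; trivial⟩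
  obtain ⟨m, hm⟩ : ∃ m, Nat.find hex = m + 1 := by
    refine Nat.exists_eq_succ_of_ne_zero fun h0 => ?_
    have := Nat.find_spec hex
    rw [h0, initSpan_zero] at this
    exact hy'.ne_zero (by simpa using this)
  have hmn : m + 1 ≤ n := hm ▸ Nat.find_min' hex (by rw [hy'.fst]; trivial)
  have hmem' : y'.1 ∈ initSpan k y'.2.1 (m + 1) := hm ▸ Nat.find_spec hex
  have hmem : y.1 ∈ initSpan k y.2.1 (m + 1) := by
    have h1 := (hle (m + 1) (m + 1)).2
    rw [(bar y hy (fun i j => (hle i j).1) _ hmn _ hmn).2,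
      (bar y' hy' (fun i j => le_rfl) _ hmn _ hmn).2, max_self, if_pos hmem'] at h1
    by_contra hnot
    rw [if_neg hnot] at h1
    omega
  set f := y.2.1 m with hf
  have hfnot : f ∉ initSpan k y.2.1 m := by
    intro h
    have h1 := finrank_initSpan hn hy.fst hmn
    rw [initSpan_succ, finrank_sup_span_singleton_of_mem h,
      finrank_initSpan hn hy.fst (by omega)] at h1
    omega
  refine mem_polyHull_of_line (k := k) y (f, 0, 0)
    (bad := {τ | y.1 + τ • f ∈ initSpan k y.2.1 m}) (Set.Subsingleton.finite ?_) ?_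
  · intro τ h1 τ' h1'
    by_contra hne
    have h3 : (τ - τ') • f ∈ initSpan k y.2.1 m := by
      have := sub_mem (show y.1 + τ • f ∈ initSpan k y.2.1 m from h1)
        (show y.1 + τ' • f ∈ initSpan k y.2.1 m from h1')
      rwa [add_sub_add_left_eq_sub, ← sub_smul] at this
    exact hfnot (((initSpan k y.2.1 m).smul_mem_iff (sub_ne_zero.2 hne)).1 h3)
  · intro τ hτ
    have hτ' : y.1 + τ • f ∉ initSpan k y.2.1 m := hτ
    have hcurve : y + τ • ((f, 0, 0) : FrameTriple V) = (y.1 + τ • f, y.2) := by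
      ext l <;> simp
    have hframed : IsFramed k n (y.1 + τ • f, y.2) :=
      ⟨fun h0 => hτ' (by rw [show y.1 + τ • f = 0 from h0]; exact zero_mem _), hy.fst, hy.snd⟩
    rw [hcurve, mem_rankCell_iff hy' hframed]
    intro i hi j hj
    rw [(bar _ hframed (fun i j => (hle i j).1) i hi j hj).1,
      (bar _ hframed (fun i j => (hle i j).1) i hi j hj).2,
      (bar y' hy' (fun i j => le_rfl) i hi j hj).1, (bar y' hy' (fun i j => le_rfl) i hi j hj).2]
    refine ⟨rfl, ?_⟩
    congr 1
    rcases le_or_gt (max i j) m with hmm | hmm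
    · rw [if_neg (fun h => hτ' (initSpan_mono _ hmm h)),
        if_neg (Nat.find_min hex (by omega))]
    · rw [if_pos (initSpan_mono _ hmm (add_mem hmem (smul_mem _ _ (mem_initSpan _ (by omega))))),
        if_pos (initSpan_mono _ hmm hmem')]

/-- For complete flags, the closure of a rank cell is given by the rank inequalities. -/
theorem mem_polyHull_rankCell [Infinite k] {n : ℕ} (hn : finrank k V = n)
    {y y' : FrameTriple V} (hy : IsFramed k n y) (hy' : IsFramed k n y')
    (hle : ∀ i j, frameRank k y i j ≤ frameRank k y' i j ∧
      frameRankBar k y i j ≤ frameRankBar k y' i j) :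
    y ∈ polyHull k (rankCell k n y') := by
  induction hm : totalRank k n y' using Nat.strong_induction_on generalizing y y' with
  | _ m ih =>
    subst hm
    by_cases hrow : ∃ i, i + 2 ≤ n ∧ IsGenericRow (frameRank k y') i ∧
        IsGenericRow (frameRankBar k y') i
    · obtain ⟨i, hi, hg, hg'⟩ := hrow
      exact mem_polyHull_of_generic_step hn hy hy' hle
        (fun z' hz' hlt z hz hzz' => ih _ hlt hz hz' hzz' rfl) hi hg hg'
    by_cases hcol : ∃ j, j + 2 ≤ n ∧ IsGenericRow (fun a b => frameRank k y' b a) j ∧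
        IsGenericRow (fun a b => frameRankBar k y' b a) j
    · obtain ⟨j, hj, hg, hg'⟩ := hcol
      -- Columns become rows after exchanging the sequences, which preserves the total rank, so the
      -- induction hypothesis still applies.
      have key : frameSwap k y ∈ polyHull k (rankCell k n (frameSwap k y')) := by
        refine mem_polyHull_of_generic_step hn hy.swap hy'.swap (fun i j => ?_)
          (fun z' hz' hlt z hz hzz' => ih _ (by rwa [totalRank_swap] at hlt) hz hz' hzz' rfl)
          hj (fun l => ?_) (fun l => ?_)
        · simp only [frameRank_swap, frameRankBar_swap]
          exact hle j i
        · simp only [frameRank_swap]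
          exact hg l
        · simp only [frameRankBar_swap]
          exact hg' l
      exact map_mem_polyHull (frameSwap k)
        (fun z hz => subset_polyHull _ (swap_mem_rankCell hz)) key
    · push Not at hrow hcol
      exact mem_polyHull_of_eq_max hn hy hy' hle fun i j hi hj =>
        (isRankPair hn hy').eq_max (fun i hi h => hrow i hi h.1 h.2)
          (fun j hj h => hcol j hj h.1 h.2) hi hj

end FullFlags

/-! ### Refining partial flags to complete ones. -/

section AdaptedFrames

open Submodule Module

/-- A vector of `T` that lies in as few of the subspaces `N l` as possible. -/
theorem exists_generic_vector {k V : Type*} [Field k] [Infinite k] [AddCommGroup V] [Module k V]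
    {ι : Type*} [Finite ι] (T : Submodule k V) (N : ι → Submodule k V) :
    ∃ u ∈ T, ∀ l, u ∈ N l → T ≤ N l := by
  classical
  cases nonempty_fintype ι
  -- Only the proper traces on `T` are to be avoided, and finitely many proper subspaces do not
  -- cover `T` over an infinite field.
  let s : Finset (Submodule k T) :=
    (Finset.univ.image fun l => (N l).comap T.subtype).filter (· ≠ ⊤)
  have hs : (⋃ p ∈ s, (p : Set T)) ≠ Set.univ :=
    Subspace.biUnion_ne_univ_of_top_notMem (by simp [s])
  obtain ⟨u, hu⟩ := (Set.ne_univ_iff_exists_notMem _).1 hs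
  refine ⟨u, u.2, fun l hl => ?_⟩
  by_contra hT
  refine hu (Set.mem_biUnion (x := (N l).comap T.subtype) ?_ hl)
  simp only [s, Finset.coe_filter, Finset.mem_image, Finset.mem_univ, true_and, Set.mem_ofPred_eq]
  refine ⟨⟨l, rfl⟩, fun htop => hT fun v hv => ?_⟩
  have : (⟨v, hv⟩ : T) ∈ (N l).comap T.subtype := htop ▸ trivial
  exact this

/-- The vectors are chosen greedily, each generic in its `T s` with respect to the spaces `N l`
enlarged by the span of the earlier choices. -/
theorem exists_generic_sequence {k V : Type*} [Field k] [Infinite k] [AddCommGroup V] [Module k V]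
    {ι : Type*} [Finite ι] (T : ℕ → Submodule k V) (N : ι → Submodule k V) :
    ∃ β : ℕ → V, ∀ s, β s ∈ T s ∧
      ∀ l, β s ∈ initSpan k β s ⊔ N l → T s ≤ initSpan k β s ⊔ N l := by
  choose g hgT hg using fun (s : ℕ) (F : Submodule k V) =>
    exists_generic_vector (T s) fun l => F ⊔ N l
  let F : ℕ → Submodule k V := fun s => Nat.rec ⊥ (fun s F => F ⊔ span k {g s F}) s
  have hF : ∀ s, initSpan k (fun s => g s (F s)) s = F s := by
    intro s
    induction s with
    | zero => exact initSpan_zero _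
    | succ s ih => rw [initSpan_succ, ih]
  refine ⟨fun s => g s (F s), fun s => ⟨hgT _ _, fun l => ?_⟩⟩
  rw [hF]
  exact hg s (F s) l

theorem finrank_initSpan_add_sup_le {k V : Type*} [Field k] [AddCommGroup V] [Module k V]
    [FiniteDimensional k V] (β : ℕ → V) (N : Submodule k V) (t d : ℕ) :
    finrank k ↥(initSpan k β (t + d) ⊔ N) ≤ finrank k ↥(initSpan k β t ⊔ N) + d := by
  induction d with
  | zero => simp
  | succ d ih =>
    rw [← add_assoc, initSpan_succ, sup_right_comm]
    have := finrank_sup_span_singleton_le (initSpan k β (t + d) ⊔ N) (β (t + d))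
    omega

theorem partialSum_zero {q : ℕ} (b : Fin q → ℕ) : partialSum b 0 = 0 := by
  simp [partialSum]

theorem partialSum_last {q : ℕ} (b : Fin q → ℕ) : partialSum b (Fin.last q) = ∑ i, b i := by
  simp [partialSum]

theorem partialSum_mono {q : ℕ} (b : Fin q → ℕ) : Monotone (partialSum b) := by
  refine fun i j h => Finset.sum_le_sum fun a _ => ?_
  have : i.val ≤ j.val := h
  split_ifs <;> omega

theorem exists_partialSum_le {q : ℕ} (b : Fin q → ℕ) {s : ℕ} (i : Fin (q + 1))
    (h : s ≤ partialSum b i) :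
    s = 0 ∨ ∃ i : Fin q, partialSum b i.castSucc ≤ s ∧ s ≤ partialSum b i.succ := by
  induction i using Fin.induction with
  | zero => rw [partialSum_zero] at h; omega
  | succ i ih =>
    by_cases h' : s ≤ partialSum b i.castSucc
    · exact ih h'
    · exact Or.inr ⟨i, by omega, h⟩

variable {k : Type*} [Field k] {n q r : ℕ} {b : Fin q → ℕ} {c : Fin r → ℕ}

/-- A sequence of vectors whose initial segments span the spaces of the flag. -/
def PartialFlag.IsAdapted (F : PartialFlag k n b) (β : ℕ → Fin n → k) : Prop :=
  ∀ i, initSpan k β (partialSum b i) = F.space i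

/-- Each generic vector of `B_{i+1}` raises the dimension of the sum with `N l` by one until
`B_{i+1} + N l` is filled. The resulting minimum is the largest value that any adapted sequence can
reach. -/
theorem PartialFlag.exists_adapted [Infinite k] (F : PartialFlag k n b) {ι : Type*} [Finite ι]
    (N : ι → Submodule k (Fin n → k)) :
    ∃ β : ℕ → Fin n → k, F.IsAdapted β ∧ ∀ (i : Fin q) (d : ℕ), d ≤ b i → ∀ l,
      finrank k ↥(initSpan k β (partialSum b i.castSucc + d) ⊔ N l) =
        min (finrank k ↥(F.space i.castSucc ⊔ N l) + d) (finrank k ↥(F.space i.succ ⊔ N l)) := by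
  -- The smallest space of the flag of dimension greater than `s`; once there is none, the empty
  -- infimum is `⊤`.
  let T : ℕ → Submodule k (Fin n → k) := fun s => ⨅ i : {i : Fin (q + 1) // s < partialSum b i},
    F.space i
  have hT : ∀ (i : Fin q) (s : ℕ), partialSum b i.castSucc ≤ s → s < partialSum b i.succ →
      T s = F.space i.succ := by
    intro i s h1 h2
    refine le_antisymm (iInf_le_of_le ⟨i.succ, h2⟩ le_rfl) (le_iInf fun j => F.mono ?_)
    by_contra hlt
    have : j.1 ≤ i.castSucc := by
      rw [not_le] at hlt
      exact Nat.lt_succ_iff.1 hlt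
    have := partialSum_mono b this
    have := j.2
    omega
  -- The extra index `none` stands for the zero space: genericity with respect to it makes the spans
  -- grow to the full dimension, so that `β` is adapted.
  obtain ⟨β, hβ⟩ := exists_generic_sequence T (fun l : Option ι => l.elim ⊥ N)
  have key : ∀ i : Fin q, initSpan k β (partialSum b i.castSucc) = F.space i.castSucc →
      ∀ d ≤ b i, initSpan k β (partialSum b i.castSucc + d) ≤ F.space i.succ ∧ ∀ l : Option ι,
      finrank k ↥(initSpan k β (partialSum b i.castSucc + d) ⊔ l.elim ⊥ N) =
        min (finrank k ↥(F.space i.castSucc ⊔ l.elim ⊥ N) + d)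
          (finrank k ↥(F.space i.succ ⊔ l.elim ⊥ N)) := by
    intro i hi d
    have hle : F.space i.castSucc ≤ F.space i.succ := F.mono i.castSucc_le_succ
    induction d with
    | zero =>
      intro _
      rw [add_zero, hi]
      exact ⟨hle, fun l => (min_eq_left (finrank_mono (sup_le_sup_right hle _))).symm⟩
    | succ d ih =>
      intro hd
      obtain ⟨ih1, ih2⟩ := ih (by omega)
      obtain ⟨m1, m2⟩ := hβ (partialSum b i.castSucc + d)
      rw [hT i _ (by omega) (by rw [partialSum_succ]; omega)] at m1 m2
      have h1 : initSpan k β (partialSum b i.castSucc + (d + 1)) ≤ F.space i.succ := by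
        rw [← add_assoc, initSpan_succ]
        exact sup_le ih1 (by simpa using m1)
      refine ⟨h1, fun l => ?_⟩
      have h2 := finrank_mono (sup_le_sup_right h1 (l.elim ⊥ N))
      have h3 := ih2 l
      have h4 := finrank_mono (sup_le_sup_right ih1 (l.elim ⊥ N))
      rw [← add_assoc, initSpan_succ, sup_right_comm] at h2 ⊢
      by_cases hmem : β (partialSum b i.castSucc + d) ∈
          initSpan k β (partialSum b i.castSucc + d) ⊔ l.elim ⊥ N
      · rw [finrank_sup_span_singleton_of_mem hmem] at h2 ⊢
        have h5 := finrank_mono (sup_le (m2 l hmem) le_sup_right :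
          F.space i.succ ⊔ l.elim ⊥ N ≤ _)
        omega
      · rw [finrank_sup_span_singleton_of_notMem hmem] at h2 ⊢
        omega
  have hadapt : F.IsAdapted β := by
    intro i
    induction i using Fin.induction with
    | zero => rw [partialSum_zero, initSpan_zero, F.space_zero]
    | succ i ih =>
      obtain ⟨h1, h2⟩ := key i ih (b i) le_rfl
      rw [partialSum_succ]
      refine eq_of_le_of_finrank_le h1 ?_
      have h3 : finrank k ↥(initSpan k β (partialSum b i.castSucc + b i) ⊔ ⊥) =
          min (finrank k ↥(F.space i.castSucc ⊔ ⊥) + b i) (finrank k ↥(F.space i.succ ⊔ ⊥)) := h2 none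
      rw [sup_bot_eq, sup_bot_eq, sup_bot_eq] at h3
      rw [h3, F.finrank_succ, min_self]
  exact ⟨β, hadapt, fun i d hd l => (key i (hadapt _) d hd).2 (some l)⟩

/-- Any adapted sequence obeys both upper bounds in the minimum that the generic sequence attains,
and both bounds are monotone in the ranks of the partial flags. -/
theorem PartialFlag.IsAdapted.finrank_le {F F' : PartialFlag k n b} {β β' : ℕ → Fin n → k}
    (hβ : F.IsAdapted β) {ι : Type*} {N N' : ι → Submodule k (Fin n → k)}
    (hβ' : ∀ (i : Fin q) (d : ℕ), d ≤ b i → ∀ l,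
      finrank k ↥(initSpan k β' (partialSum b i.castSucc + d) ⊔ N' l) =
        min (finrank k ↥(F'.space i.castSucc ⊔ N' l) + d) (finrank k ↥(F'.space i.succ ⊔ N' l)))
    (h : ∀ i l, finrank k ↥(F.space i ⊔ N l) ≤ finrank k ↥(F'.space i ⊔ N' l))
    {s : ℕ} (hs : s ≤ ∑ i, b i) (l : ι) :
    finrank k ↥(initSpan k β s ⊔ N l) ≤ finrank k ↥(initSpan k β' s ⊔ N' l) := by
  rw [← partialSum_last] at hs
  rcases exists_partialSum_le b _ hs with rfl | ⟨i, h1, h2⟩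
  · have := h 0 l
    rw [F.space_zero, F'.space_zero] at this
    rwa [initSpan_zero, initSpan_zero]
  · obtain ⟨d, rfl⟩ := Nat.exists_eq_add_of_le h1
    rw [partialSum_succ] at h2
    rw [hβ' i d (by omega) l]
    refine le_min ?_ ?_
    · refine (finrank_initSpan_add_sup_le _ _ _ _).trans ?_
      rw [hβ i.castSucc]
      exact Nat.add_le_add_right (h _ _) _
    · refine le_trans (finrank_mono (sup_le_sup_right ?_ _)) (h i.succ l)
      rw [← hβ i.succ, partialSum_succ]
      exact initSpan_mono β h2

/-- The vector and the two sequences of vectors define the triple flag. -/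
structure TripleFlag.IsFrame (x : TripleFlag k n b c) (y : FrameTriple (Fin n → k)) : Prop where
  line : x.line.submodule = span k {y.1}
  fst : x.fst.IsAdapted y.2.1
  snd : x.snd.IsAdapted y.2.2

theorem TripleFlag.IsFrame.isFramed {x : TripleFlag k n b c} {y : FrameTriple (Fin n → k)}
    (h : x.IsFrame y) (hbn : ∑ i, b i = n) (hcn : ∑ j, c j = n) : IsFramed k n y := by
  refine ⟨fun h0 => ?_, ?_, ?_⟩
  · have := x.line.finrank_submodule
    rw [h.line, h0, span_zero_singleton, finrank_bot] at this
    omega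
  · rw [← x.fst.space_last, ← h.fst, partialSum_last, hbn]
  · rw [← x.snd.space_last, ← h.snd, partialSum_last, hcn]

theorem IsFramed.exists_tripleFlag {y : FrameTriple (Fin n → k)} (h : IsFramed k n y)
    (hbn : ∑ i, b i = n) (hcn : ∑ j, c j = n) : ∃ x : TripleFlag k n b c, x.IsFrame y := by
  have hn : finrank k (Fin n → k) = n := by simp
  have key : ∀ {q : ℕ} (b : Fin q → ℕ) (β : ℕ → Fin n → k), initSpan k β n = ⊤ → ∑ i, b i = n →
      ∃ F : PartialFlag k n b, F.IsAdapted β := by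
    intro q b β hβ hbn
    have hle : ∀ i, partialSum b i ≤ n := fun i => by
      rw [← hbn, ← partialSum_last]
      exact partialSum_mono b (Fin.le_last i)
    exact ⟨{  space := fun i => initSpan k β (partialSum b i)
              space_zero := by rw [partialSum_zero, initSpan_zero]
              space_last := by rw [partialSum_last, hbn, hβ]
              mono := fun i j hij => initSpan_mono β (partialSum_mono b hij)
              finrank_succ := fun i => by
                rw [finrank_initSpan hn hβ (hle _), finrank_initSpan hn hβ (hle _),
                  partialSum_succ] }, fun i => rfl⟩
  obtain ⟨B, hB⟩ := key b _ h.fst hbn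
  obtain ⟨C, hC⟩ := key c _ h.snd hcn
  exact ⟨⟨Projectivization.mk k y.1 h.ne_zero, B, C⟩, Projectivization.submodule_mk _ _, hB, hC⟩

/-- `dim (B_i + C_j)`. -/
noncomputable def TripleFlag.sumRank (x : TripleFlag k n b c) (i : Fin (q + 1)) (j : Fin (r + 1)) :
    ℕ :=
  finrank k ↥(x.fst.space i ⊔ x.snd.space j)

/-- `dim (A + B_i + C_j)`. -/
noncomputable def TripleFlag.sumRankBar (x : TripleFlag k n b c) (i : Fin (q + 1))
    (j : Fin (r + 1)) : ℕ :=
  finrank k ↥(x.fst.space i ⊔ (x.snd.space j ⊔ x.line.submodule))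

theorem TripleFlag.IsFrame.frameRank {x : TripleFlag k n b c} {y : FrameTriple (Fin n → k)}
    (h : x.IsFrame y) (i : Fin (q + 1)) (j : Fin (r + 1)) :
    frameRank k y (partialSum b i) (partialSum c j) = x.sumRank i j ∧
      frameRankBar k y (partialSum b i) (partialSum c j) = x.sumRankBar i j := by
  rw [_root_.frameRank, frameRankBar, h.fst, h.snd, ← h.line]
  exact ⟨rfl, rfl⟩

/-- Generic refinement of `x'` makes its ranks maximal, so any refinement of `x` stays below. The
first flag of `x'` is refined with respect to `C'_j` and `A' + C'_j`; the second one then with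
respect to all spaces of the refined first flag, again with and without the line. -/
theorem TripleFlag.exists_frames [Infinite k] (hbn : ∑ i, b i = n) (hcn : ∑ j, c j = n)
    {x x' : TripleFlag k n b c}
    (h : ∀ i j, x.sumRank i j ≤ x'.sumRank i j ∧ x.sumRankBar i j ≤ x'.sumRankBar i j) :
    ∃ y y' : FrameTriple (Fin n → k), x.IsFrame y ∧ x'.IsFrame y' ∧
      ∀ i j, frameRank k y i j ≤ frameRank k y' i j ∧ frameRankBar k y i j ≤ frameRankBar k y' i j := by
  -- The empty index type: no genericity is asked of the frame of `x`.
  obtain ⟨β, hβ, -⟩ := x.fst.exists_adapted (fun l : Empty => l.elim)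
  obtain ⟨γ, hγ, -⟩ := x.snd.exists_adapted (fun l : Empty => l.elim)
  obtain ⟨β', hβ', gβ'⟩ := x'.fst.exists_adapted (fun l : Bool × Fin (r + 1) =>
    cond l.1 (x'.snd.space l.2) (x'.snd.space l.2 ⊔ x'.line.submodule))
  obtain ⟨γ', hγ', gγ'⟩ := x'.snd.exists_adapted (fun l : Bool × Fin (n + 1) =>
    cond l.1 (initSpan k β' l.2) (initSpan k β' l.2 ⊔ x'.line.submodule))
  have c1 : ∀ s ≤ ∑ i, b i, ∀ l : Bool × Fin (r + 1), _ := fun s hs l =>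
    hβ.finrank_le (N := fun l : Bool × Fin (r + 1) =>
      cond l.1 (x.snd.space l.2) (x.snd.space l.2 ⊔ x.line.submodule)) gβ' (by
        rintro i ⟨_ | _, j⟩
        · exact (h i j).2
        · exact (h i j).1) hs l
  have c2 : ∀ t ≤ ∑ j, c j, ∀ l : Bool × Fin (n + 1), _ := fun t ht l =>
    hγ.finrank_le (N := fun l : Bool × Fin (n + 1) =>
      cond l.1 (initSpan k β l.2) (initSpan k β l.2 ⊔ x.line.submodule)) gγ' (by
        rintro j ⟨_ | _, s⟩
        · have := c1 s (by omega) (false, j)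
          change finrank k ↥(x.snd.space j ⊔ (initSpan k β s ⊔ x.line.submodule)) ≤
            finrank k ↥(x'.snd.space j ⊔ (initSpan k β' s ⊔ x'.line.submodule))
          rwa [sup_left_comm, sup_left_comm (x'.snd.space j)]
        · have := c1 s (by omega) (true, j)
          change finrank k ↥(x.snd.space j ⊔ initSpan k β s) ≤
            finrank k ↥(x'.snd.space j ⊔ initSpan k β' s)
          rwa [sup_comm, sup_comm (x'.snd.space j)]) ht l
  have hl : ∀ z : TripleFlag k n b c, z.line.submodule = span k {z.line.rep} :=
    fun z => Projectivization.submodule_eq _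
  have hy : x.IsFrame (x.line.rep, β, γ) := ⟨hl x, hβ, hγ⟩
  have hy' : x'.IsFrame (x'.line.rep, β', γ') := ⟨hl x', hβ', hγ'⟩
  refine ⟨_, _, hy, hy', fun i j => ?_⟩
  have fy := hy.isFramed hbn hcn
  have fy' := hy'.isFramed hbn hcn
  rw [(frameRank_min fy i j).1, (frameRank_min fy i j).2, (frameRank_min fy' i j).1,
    (frameRank_min fy' i j).2, frameRank, frameRank, frameRankBar, frameRankBar]
  have e1 : finrank k ↥(initSpan k γ (min j n) ⊔ initSpan k β (min i n)) ≤
      finrank k ↥(initSpan k γ' (min j n) ⊔ initSpan k β' (min i n)) :=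
    c2 (min j n) (by omega) (true, ⟨min i n, by omega⟩)
  have e2 : finrank k ↥(initSpan k γ (min j n) ⊔ (initSpan k β (min i n) ⊔ x.line.submodule)) ≤
      finrank k ↥(initSpan k γ' (min j n) ⊔ (initSpan k β' (min i n) ⊔ x'.line.submodule)) :=
    c2 (min j n) (by omega) (false, ⟨min i n, by omega⟩)
  rw [sup_comm, sup_comm (initSpan k γ' _)] at e1
  rw [sup_left_comm, sup_left_comm (initSpan k γ' _), hl, hl] at e2
  exact ⟨e1, e2⟩

end AdaptedFrames

/-! ### Plücker coordinates: continuity and semicontinuity. -/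

section PluckerCoordinates

open Submodule Module

variable {k : Type*} [Field k] {n q r : ℕ} {b : Fin q → ℕ} {c : Fin r → ℕ}

/-- The `j`-th basis vector of the subspace with a given label. -/
def frameVec (y : FrameTriple (Fin n → k)) (s : SpaceLabel q r) (j : ℕ) : Fin n → k :=
  Sum.elim (fun _ => y.1) (Sum.elim (fun _ => y.2.1 j) (fun _ => y.2.2 j)) s

/-- The Plücker coordinates of the triple flag with a given frame. -/
def framePlucker (b : Fin q → ℕ) (c : Fin r → ℕ) (y : FrameTriple (Fin n → k)) :
    PluckerIndex n b c → k :=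
  fun t => (Matrix.of fun i j : Fin (labelDim b c t.1) => frameVec y t.1 j (t.2 i)).det

theorem frameVec_mem_polyFun (s : SpaceLabel q r) (j : ℕ) (i : Fin n) :
    (fun y : FrameTriple (Fin n → k) => frameVec y s j i) ∈ polyFun k (FrameTriple (Fin n → k)) := by
  rcases s with _ | _ | _
  · exact dual_mem_polyFun
      { toFun := fun y : FrameTriple (Fin n → k) => y.1 i
        map_add' := fun _ _ => rfl
        map_smul' := fun _ _ => rfl }
  · exact dual_mem_polyFun
      { toFun := fun y : FrameTriple (Fin n → k) => y.2.1 j i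
        map_add' := fun _ _ => rfl
        map_smul' := fun _ _ => rfl }
  · exact dual_mem_polyFun
      { toFun := fun y : FrameTriple (Fin n → k) => y.2.2 j i
        map_add' := fun _ _ => rfl
        map_smul' := fun _ _ => rfl }

/-- Minors are polynomials in the coordinates of the frame vectors. Hence closed conditions on
triple flags pull back to polynomial conditions on frames. -/
theorem eval_framePlucker_mem_polyFun (P : MvPolynomial (PluckerIndex n b c) k) :
    (fun y => MvPolynomial.eval (framePlucker b c y) P) ∈ polyFun k (FrameTriple (Fin n → k)) := by
  induction P using MvPolynomial.induction_on with
  | C a =>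
    simp only [MvPolynomial.eval_C]
    exact (polyFun k _).algebraMap_mem a
  | add p p' hp hp' =>
    simp only [map_add]
    exact (polyFun k _).add_mem hp hp'
  | mul_X p t hp =>
    simp only [map_mul, MvPolynomial.eval_X]
    refine (polyFun k _).mul_mem hp ?_
    have : (fun y => framePlucker b c y t) = ∑ σ : Equiv.Perm (Fin (labelDim b c t.1)),
        Equiv.Perm.sign σ • ∏ j : Fin (labelDim b c t.1), fun y : FrameTriple (Fin n → k) =>
          frameVec y t.1 j (t.2 (σ j)) := by
      ext y
      simp [framePlucker, Matrix.det_apply, Finset.sum_apply, Finset.prod_apply]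
    rw [this]
    refine (polyFun k _).sum_mem fun σ _ => ?_
    have h := (polyFun k _).prod_mem (t := Finset.univ) fun (j : Fin (labelDim b c t.1)) _ =>
      frameVec_mem_polyFun t.1 j (t.2 (σ j))
    rcases Int.units_eq_one_or (Equiv.Perm.sign σ) with h1 | h1 <;> rw [h1]
    · rwa [one_smul]
    · rw [Units.neg_smul, one_smul]
      exact (polyFun k _).neg_mem h

theorem TripleFlag.IsFrame.isPlucker {x : TripleFlag k n b c} {y : FrameTriple (Fin n → k)}
    (h : x.IsFrame y) : x.IsPlucker (framePlucker b c y) := by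
  have hspan : ∀ s : SpaceLabel q r,
      span k (Set.range fun j : Fin (labelDim b c s) => frameVec y s j) = x.space s := by
    have key : ∀ (d : ℕ) (β : ℕ → Fin n → k),
        span k (Set.range fun j : Fin d => β j) = initSpan k β d := by
      intro d β
      rw [initSpan]
      congr 1
      ext v
      constructor
      · rintro ⟨j, rfl⟩
        exact ⟨j, j.2, rfl⟩
      · rintro ⟨j, hj, rfl⟩
        exact ⟨⟨j, hj⟩, rfl⟩
    rintro (_ | i | j)
    · change span k (Set.range fun _ : Fin 1 => y.1) = x.line.submodule
      rw [h.line, Set.range_const]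
    · exact (key _ _).trans (h.fst i)
    · exact (key _ _).trans (h.snd j)
  refine ⟨fun s j => frameVec y s j, fun s => ?_, hspan, fun s I => rfl⟩
  rw [linearIndependent_iff_card_eq_finrank_span, Fintype.card_fin, Set.finrank, hspan,
    x.finrank_space]

theorem TripleFlag.isClosed_zeroLocus {S : Set (MvPolynomial (PluckerIndex n b c) k)}
    (h : ∀ P ∈ S, ∃ e, IsMultihomogeneous P e) : IsClosed (TripleFlag.zeroLocus S) := by
  rw [← isOpen_compl_iff]
  change (TripleFlag.zeroLocus S)ᶜᶜ ∈ {Z | TripleFlag.IsAlgebraic Z}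
  rw [compl_compl]
  exact ⟨S, h, rfl⟩

theorem TripleFlag.isAlgebraic_of_isClosed {Z : Set (TripleFlag k n b c)} (h : IsClosed Z) :
    TripleFlag.IsAlgebraic Z := by
  rw [← isOpen_compl_iff] at h
  have h' : Zᶜᶜ ∈ {Z | TripleFlag.IsAlgebraic Z} := h
  rwa [compl_compl] at h'

/-- The map from frames to triple flags is continuous. -/
theorem TripleFlag.mem_closure_of_mem_polyHull {x : TripleFlag k n b c}
    {y : FrameTriple (Fin n → k)} (hy : x.IsFrame y) {S : Set (FrameTriple (Fin n → k))}
    (hS : y ∈ polyHull k S) {T : Set (TripleFlag k n b c)}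
    (h : ∀ z ∈ S, ∃ w ∈ T, w.IsFrame z) : x ∈ closure T := by
  obtain ⟨P, hP, hZ⟩ := TripleFlag.isAlgebraic_of_isClosed (isClosed_closure (s := T))
  rw [hZ]
  intro p hp
  refine ⟨framePlucker b c y, hy.isPlucker, hS _ (eval_framePlucker_mem_polyFun p) fun z hz => ?_⟩
  obtain ⟨w, hw, hwz⟩ := h z hz
  have hw' := subset_closure hw
  rw [hZ] at hw'
  obtain ⟨e, he⟩ := hP p hp
  exact (TripleFlag.vanishes_iff he hwz.isPlucker).1 (hw' p hp)

theorem exists_linearIndependent_mem_of_le_finrank {V : Type*} [AddCommGroup V] [Module k V]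
    [FiniteDimensional k V] {s : Set V} {m : ℕ} (h : m ≤ finrank k ↥(span k s)) :
    ∃ f : Fin m → V, (∀ i, f i ∈ s) ∧ LinearIndependent k f := by
  obtain ⟨f, hf, -, hli⟩ := Submodule.exists_fun_fin_finrank_span_eq k s
  exact ⟨fun i => f (Fin.castLE h i), fun i => hf _, hli.comp _ (Fin.castLE_injective h)⟩

/-- Among `m` independent vectors with `n` coordinates one finds a nonzero `m × m` minor. -/
theorem exists_det_ne_zero {m : ℕ} {X : Fin m → Fin n → k} (h : LinearIndependent k X) :
    ∃ I : Fin m → Fin n, (Matrix.of fun i j => X j (I i)).det ≠ 0 := by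
  have h1 : finrank k ↥(span k (Set.range (Matrix.of X).col)) = m := by
    rw [← Matrix.rank_eq_finrank_span_cols, Matrix.rank_eq_finrank_span_row]
    exact (linearIndependent_iff_card_eq_finrank_span.1 h).symm.trans (Fintype.card_fin m)
  obtain ⟨f, hf, hli⟩ := exists_linearIndependent_mem_of_le_finrank h1.ge
  choose I hI using hf
  refine ⟨I, ?_⟩
  have h2 : (Matrix.of fun i j => X j (I i)).row = f := by
    ext i j
    rw [← hI i]
    rfl
  rw [← h2, Matrix.linearIndependent_rows_iff_isUnit, Matrix.isUnit_iff_isUnit_det] at hli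
  exact hli.ne_zero

/-- A vector of Plücker coordinates whose indices differ in one place only. -/
def pluckerVec (p : PluckerIndex n b c → k) (s : SpaceLabel q r)
    (t : (Fin (labelDim b c s) → Fin n) × Fin (labelDim b c s)) : Fin n → k :=
  fun i => p ⟨s, Function.update t.1 t.2 i⟩

/-- The Plücker coordinates of a subspace provide vectors that span it. -/
theorem TripleFlag.IsPlucker.span_pluckerVec {x : TripleFlag k n b c} {p : PluckerIndex n b c → k}
    (hp : x.IsPlucker p) (s : SpaceLabel q r) :
    span k (Set.range (pluckerVec p s)) = x.space s := by
  obtain ⟨X, hli, hspan, hX⟩ := hp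
  refine eq_of_le_of_finrank_le ?_ ?_
  · refine span_le.2 ?_
    rintro _ ⟨⟨I, l⟩, rfl⟩
    let A : Matrix (Fin (labelDim b c s)) (Fin (labelDim b c s)) k := Matrix.of fun i j => X s j (I i)
    -- The determinant is linear in its `l`-th row. Expanding in this row exhibits the Plücker
    -- vector as a combination of the vectors `X s j`.
    let φ : (Fin (labelDim b c s) → k) →ₗ[k] k := LinearMap.proj l ∘ₗ Matrix.cramer A.transpose
    have h1 : pluckerVec p s (I, l) = ∑ j, φ (fun i => if j = i then 1 else 0) • X s j := by
      ext i
      have h2 : (Matrix.of fun a j => X s j (Function.update I l i a)) =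
          A.updateRow l fun j => X s j i := by
        ext a j
        by_cases h : a = l
        · subst h; simp
        · simp [A, h]
      rw [pluckerVec, hX, h2, ← Matrix.cramer_transpose_apply]
      change φ (fun j => X s j i) = _
      rw [LinearMap.pi_apply_eq_sum_univ φ, Finset.sum_apply]
      exact Finset.sum_congr rfl fun j _ => by simp [mul_comm]
    rw [h1, ← hspan s]
    exact sum_mem fun j _ => smul_mem _ _ (subset_span ⟨j, rfl⟩)
  · rw [x.finrank_space]
    -- Changing one index of a nonzero minor at a time gives independent vectors: at the coordinate
    -- `I l` all but the `l`-th vanish, by a repeated row.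
    obtain ⟨I, hI⟩ := exists_det_ne_zero (hli s)
    have hw : LinearIndependent k fun l => pluckerVec p s (I, l) := by
      rw [Fintype.linearIndependent_iff]
      intro g hg l
      have h1 := congrFun hg (I l)
      rw [Finset.sum_apply, Finset.sum_eq_single l] at h1
      · simp only [Pi.smul_apply, pluckerVec, Function.update_eq_self, hX, smul_eq_mul,
          Pi.zero_apply] at h1
        exact (mul_eq_zero.1 h1).resolve_right hI
      · intro l' _ hne
        have h2 : pluckerVec p s (I, l') (I l) = 0 := by
          rw [pluckerVec, hX]
          refine Matrix.det_zero_of_row_eq hne ?_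
          ext j
          simp [Function.update_of_ne hne.symm]
        rw [Pi.smul_apply, h2, smul_zero]
      · simp
    have h1 := finrank_span_eq_card hw
    rw [Fintype.card_fin] at h1
    refine h1.symm.le.trans (finrank_mono (span_mono ?_))
    rintro _ ⟨l, rfl⟩
    exact ⟨_, rfl⟩

/-- The dimension of a sum of subspaces of a triple flag is lower semicontinuous. -/
theorem TripleFlag.isClosed_finrank_le (T : Set (SpaceLabel q r)) (m : ℕ) :
    IsClosed {x : TripleFlag k n b c | finrank k ↥(⨆ s ∈ T, x.space s) ≤ m} := by
  -- The sum of the chosen subspaces is the column space of a matrix whose columns are all their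
  -- Plücker vectors; its minors of size `m + 1` are the equations.
  let Idx := Σ s : T, (Fin (labelDim b c s.1) → Fin n) × Fin (labelDim b c s.1)
  let minor : (Fin (m + 1) → Idx) → (Fin (m + 1) → Fin n) →
      MvPolynomial (PluckerIndex n b c) k := fun K J =>
    (Matrix.of fun i j => MvPolynomial.X
      (⟨(K j).1, Function.update (K j).2.1 (K j).2.2 (J i)⟩ : PluckerIndex n b c)).det
  have heval : ∀ (p : PluckerIndex n b c → k) K J, MvPolynomial.eval p (minor K J) =
      (Matrix.of fun i j => pluckerVec p (K j).1 (K j).2 (J i)).det := by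
    intro p K J
    rw [RingHom.map_det]
    congr 1
    ext i j
    simp [pluckerVec]
  have hhom : ∀ K J, ∃ e, IsMultihomogeneous (minor K J) e := by
    intro K J
    -- Each column contributes degree one in the coordinates of the subspace it belongs to.
    refine ⟨∑ j, Pi.single (K j).1.1 1, ?_⟩
    rw [IsMultihomogeneous]
    simp only [minor, Matrix.det_apply]
    refine MvPolynomial.IsWeightedHomogeneous.sum _ _ _ fun σ _ => ?_
    have h := MvPolynomial.IsWeightedHomogeneous.prod (R := k) Finset.univ
      (fun j => MvPolynomial.X
        (⟨(K j).1, Function.update (K j).2.1 (K j).2.2 (J (σ j))⟩ : PluckerIndex n b c))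
      (fun j => Pi.single (K j).1.1 1)
      (w := fun t : PluckerIndex n b c => (Pi.single t.1 1 : SpaceLabel q r → ℕ))
      fun j _ => MvPolynomial.isWeightedHomogeneous_X _ _ _
    rcases Int.units_eq_one_or (Equiv.Perm.sign σ) with h1 | h1 <;> rw [h1]
    · rwa [one_smul]
    · rw [Units.neg_smul, one_smul]
      exact (MvPolynomial.weightedHomogeneousSubmodule k _ _).neg_mem h
  have hspan : ∀ (x : TripleFlag k n b c) p, x.IsPlucker p → ⨆ s ∈ T, x.space s =
      span k (Set.range fun t : Idx => pluckerVec p t.1.1 t.2) := by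
    intro x p hp
    have h1 : (Set.range fun t : Idx => pluckerVec p t.1.1 t.2) =
        ⋃ s ∈ T, Set.range (pluckerVec p s) := by
      ext v
      simp only [Set.mem_range, Set.mem_iUnion]
      constructor
      · rintro ⟨⟨s, t⟩, rfl⟩
        exact ⟨s.1, s.2, t, rfl⟩
      · rintro ⟨s, hs, t, rfl⟩
        exact ⟨⟨⟨s, hs⟩, t⟩, rfl⟩
    rw [h1]
    simp only [span_iUnion, hp.span_pluckerVec]
  have : {x : TripleFlag k n b c | finrank k ↥(⨆ s ∈ T, x.space s) ≤ m} =
      TripleFlag.zeroLocus {P | ∃ K J, P = minor K J} := by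
    ext x
    obtain ⟨p, hp⟩ := x.exists_isPlucker
    constructor
    · rintro hx _ ⟨K, J, rfl⟩
      refine ⟨p, hp, ?_⟩
      have hx' : finrank k ↥(⨆ s ∈ T, x.space s) ≤ m := hx
      rw [heval]
      by_contra hne
      have hli : LinearIndependent k fun j => pluckerVec p (K j).1 (K j).2 := by
        have h1 := Matrix.linearIndependent_cols_iff_isUnit.2
          ((Matrix.isUnit_iff_isUnit_det _).2 (isUnit_iff_ne_zero.2 hne))
        exact LinearIndependent.of_comp (LinearMap.funLeft k k J) h1
      have h2 := finrank_span_eq_card hli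
      rw [Fintype.card_fin] at h2
      have h3 : finrank k ↥(span k (Set.range fun j => pluckerVec p (K j).1 (K j).2)) ≤
          finrank k ↥(⨆ s ∈ T, x.space s) := by
        rw [hspan x p hp]
        refine finrank_mono (span_mono ?_)
        rintro _ ⟨j, rfl⟩
        exact ⟨K j, rfl⟩
      omega
    · intro hx
      by_contra hlt
      have hlt' : ¬ finrank k ↥(⨆ s ∈ T, x.space s) ≤ m := hlt
      rw [hspan x p hp, not_le] at hlt'
      obtain ⟨f, hf, hli⟩ := exists_linearIndependent_mem_of_le_finrank (Nat.succ_le_of_lt hlt')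
      choose K hK using hf
      obtain ⟨J, hJ⟩ := exists_det_ne_zero hli
      have h1 := hx _ ⟨K, J, rfl⟩
      obtain ⟨e, he⟩ := hhom K J
      rw [TripleFlag.vanishes_iff he hp, heval] at h1
      apply hJ
      rw [← h1]
      congr 2
      ext i j
      rw [← hK j]
  rw [this]
  refine TripleFlag.isClosed_zeroLocus ?_
  rintro _ ⟨K, J, rfl⟩
  exact hhom K J

theorem TripleFlag.sumRank_le_of_mem_closure {x : TripleFlag k n b c}
    {S : Set (TripleFlag k n b c)} (hx : x ∈ closure S) (i : Fin (q + 1)) (j : Fin (r + 1)) {m : ℕ} :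
    ((∀ y ∈ S, y.sumRank i j ≤ m) → x.sumRank i j ≤ m) ∧
      ((∀ y ∈ S, y.sumRankBar i j ≤ m) → x.sumRankBar i j ≤ m) := by
  have h1 : ∀ y : TripleFlag k n b c, y.sumRank i j = finrank k
      ↥(⨆ s ∈ ({Sum.inr (Sum.inl i), Sum.inr (Sum.inr j)} : Set (SpaceLabel q r)), y.space s) := by
    intro y
    rw [iSup_pair]
    rfl
  have h2 : ∀ y : TripleFlag k n b c, y.sumRankBar i j = finrank k
      ↥(⨆ s ∈ ({Sum.inr (Sum.inl i), Sum.inr (Sum.inr j), Sum.inl ()} : Set (SpaceLabel q r)),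
        y.space s) := by
    intro y
    rw [iSup_insert, iSup_pair]
    rfl
  simp only [h1, h2]
  exact ⟨fun h => closure_minimal h (TripleFlag.isClosed_finrank_le _ m) hx,
    fun h => closure_minimal h (TripleFlag.isClosed_finrank_le _ m) hx⟩

end PluckerCoordinates

/-! ### Decorated matrices, their rank numbers and their orbits. -/

section Orbits

open Submodule Module

variable {k : Type*} [Field k] {n q r : ℕ} {b : Fin q → ℕ} {c : Fin r → ℕ}

theorem partialSum_ext {q : ℕ} {f g : Fin q → ℕ} (h : ∀ i, partialSum f i = partialSum g i) :
    f = g := by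
  ext i
  have h1 := h i.succ
  rw [partialSum_succ, partialSum_succ, h] at h1
  omega

theorem eq_partialSum {q : ℕ} {f : Fin q → ℕ} {F : Fin (q + 1) → ℕ} (h0 : F 0 = 0)
    (h : ∀ i : Fin q, F i.succ = F i.castSucc + f i) (i : Fin (q + 1)) : F i = partialSum f i := by
  induction i using Fin.induction with
  | zero => rw [h0, partialSum_zero]
  | succ i ih => rw [h, ih, partialSum_succ]

theorem span_image_inf_span_image {ι V : Type*} [AddCommGroup V] [Module k V] (v : Basis ι k V) (S T : Set ι) :
    span k (v '' S) ⊓ span k (v '' T) = span k (v '' (S ∩ T)) := by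
  ext m
  rw [mem_inf, v.mem_span_image, v.mem_span_image, v.mem_span_image, Set.subset_inter_iff]

instance (M : Matrix (Fin q) (Fin r) ℕ) (a : Fin q) : Fintype (Σ d : Fin r, Fin (M a d)) :=
  Sigma.instFintype

instance (M : Matrix (Fin q) (Fin r) ℕ) : Fintype (Σ a : Fin q, Σ d : Fin r, Fin (M a d)) :=
  Sigma.instFintype

namespace DecoratedMatrix

/-- The index set of the bases adapted to the triple flags of type `D`. -/
abbrev Index (D : DecoratedMatrix b c) : Type :=
  Σ a : Fin q, Σ d : Fin r, Fin (D.M a d)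

/-- The first index at a position of `Δ`. -/
def mark (D : DecoratedMatrix b c) (p : D.Δ) : D.Index :=
  ⟨p.1.1, p.1.2, ⟨0, D.pos p.1 p.2⟩⟩

theorem mark_injective (D : DecoratedMatrix b c) : Function.Injective D.mark := by
  rintro ⟨⟨a, d⟩, h⟩ ⟨⟨a', d'⟩, h'⟩ heq
  simp only [mark, Sigma.mk.injEq] at heq
  obtain ⟨rfl, heq⟩ := heq
  have := (Sigma.mk.inj (eq_of_heq heq)).1
  subst this
  rfl

theorem rankNum_eq_partialSum (D : DecoratedMatrix b c) (i : Fin (q + 1)) (j : Fin (r + 1)) :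
    D.rankNum i j = partialSum (fun a => partialSum (D.M a) j) i := by
  refine Finset.sum_congr rfl fun a _ => ?_
  by_cases h : a.val < i.val <;> simp [h, partialSum]

/-- The zeros of `delta` encode the positions dominated by `Δ`, and an antichain is recovered from
the set it dominates: passing to the other `Δ` and back gives `p ≤ p' ≤ p''`, whence `p = p''`. -/
theorem mem_iff_of_delta_eq {D D' : DecoratedMatrix b c} (h : ∀ i j, D.delta i j = D'.delta i j)
    {p : Fin q × Fin r} (hp : p ∈ D.Δ) : p ∈ D'.Δ := by
  have key : ∀ {D D' : DecoratedMatrix b c}, (∀ i j, D.delta i j = D'.delta i j) →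
      ∀ p ∈ D.Δ, ∃ p' ∈ D'.Δ, p.1 ≤ p'.1 ∧ p.2 ≤ p'.2 := by
    intro D D' h p hp
    have h1 : D.delta p.1.castSucc p.2.castSucc = 0 := if_pos ⟨p, hp, le_rfl, le_rfl⟩
    rw [h] at h1
    by_contra hcon
    rw [delta, if_neg (fun ⟨p', hp', h2⟩ => hcon ⟨p', hp', h2⟩)] at h1
    omega
  obtain ⟨p', hp', h1, h2⟩ := key h p hp
  obtain ⟨p'', hp'', h3, h4⟩ := key (fun i j => (h i j).symm) p' hp'
  have h5 : p = p'' := by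
    by_contra hne
    rcases D.descending p hp p'' hp'' hne with h | h
    · exact absurd (h2.trans h4) (not_le.2 h.2)
    · exact absurd (h1.trans h3) (not_le.2 h.1)
  subst h5
  rwa [Prod.ext (le_antisymm h1 h3) (le_antisymm h2 h4)]

/-- A decorated matrix is determined by its rank numbers. -/
theorem eq_of_rankNum_eq {D D' : DecoratedMatrix b c}
    (h : ∀ i j, D.rankNum i j = D'.rankNum i j ∧ D.rankNumBar i j = D'.rankNumBar i j) :
    D = D' := by
  have hM : D.M = D'.M := by
    funext a
    refine partialSum_ext fun j => ?_
    refine congrFun (partialSum_ext (f := fun a => partialSum (D.M a) j)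
      (g := fun a => partialSum (D'.M a) j) fun i => ?_) a
    rw [← rankNum_eq_partialSum, ← rankNum_eq_partialSum]
    exact (h i j).1
  have hd : ∀ i j, D.delta i j = D'.delta i j := by
    intro i j
    have h1 := h i j
    rw [rankNumBar, rankNumBar] at h1
    omega
  have hΔ : D.Δ = D'.Δ := by
    ext p
    exact ⟨mem_iff_of_delta_eq hd, mem_iff_of_delta_eq fun i j => (hd i j).symm⟩
  cases D
  cases D'
  simp only at hM hΔ
  subst hM hΔ
  rfl

theorem finrank_span_image (D : DecoratedMatrix b c) {V : Type*} [AddCommGroup V] [Module k V]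
    (v : Basis D.Index k V) (P : Fin q → Fin r → Prop) [∀ a d, Decidable (P a d)] :
    finrank k ↥(span k (v '' {t | P t.1 t.2.1})) = ∑ a, ∑ d, if P a d then D.M a d else 0 := by
  have h1 : LinearIndependent k fun t : {t : D.Index // P t.1 t.2.1} => v t :=
    v.linearIndependent.comp _ Subtype.val_injective
  have h2 : (Set.range fun t : {t : D.Index // P t.1 t.2.1} => v t) = v '' {t | P t.1 t.2.1} := by
    rw [Set.image_eq_range]
    rfl
  have h3 := finrank_span_eq_card h1
  rw [h2] at h3
  rw [h3, Fintype.card_subtype, Finset.card_filter, Fintype.sum_sigma]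
  refine Finset.sum_congr rfl fun a _ => ?_
  rw [Fintype.sum_sigma]
  refine Finset.sum_congr rfl fun d _ => ?_
  by_cases h : P a d <;> simp [h]

/-- The marks are distinct, so each has coefficient one in the sum, and membership in a coordinate
subspace is read off the support. -/
theorem sum_mark_mem_iff (D : DecoratedMatrix b c) {V : Type*} [AddCommGroup V] [Module k V]
    (v : Basis D.Index k V) (S : Set D.Index) :
    ∑ p : D.Δ, v (D.mark p) ∈ span k (v '' S) ↔ ∀ p, D.mark p ∈ S := by
  refine ⟨fun h p => ?_, fun h => sum_mem fun p _ => subset_span ⟨_, h p, rfl⟩⟩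
  rw [v.mem_span_image] at h
  refine h ?_
  classical
  rw [Finset.mem_coe, Finsupp.mem_support_iff, map_sum, Finsupp.finsetSum_apply,
    Finset.sum_eq_single p]
  · simp
  · intro p' _ hne
    rw [v.repr_self, Finsupp.single_apply, if_neg fun h => hne (D.mark_injective h)]
  · simp

theorem rankNum_of_mem_orbit {D : DecoratedMatrix b c} {x : TripleFlag k n b c}
    (hx : x ∈ D.orbit k n) (i : Fin (q + 1)) (j : Fin (r + 1)) :
    x.rankNum i j = D.rankNum i j ∧ x.rankNumBar i j = D.rankNumBar i j := by
  obtain ⟨v, hB, hC, hA⟩ := hx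
  have h1 : finrank k ↥(x.fst.space i ⊓ x.snd.space j) = D.rankNum i j := by
    rw [hB, hC, span_image_inf_span_image]
    exact D.finrank_span_image v fun a d => a.val < i.val ∧ d.val < j.val
  refine ⟨h1, ?_⟩
  rw [TripleFlag.rankNumBar, rankNumBar, h1]
  congr 1
  have hA' : x.line.submodule = span k {∑ p : D.Δ, v (D.mark p)} := hA
  have h2 : x.fst.space i ⊔ x.snd.space j =
      span k (v '' ({t | t.1.val < i.val} ∪ {t | t.2.1.val < j.val})) := by
    rw [hB, hC, Set.image_union, span_union]
  have h3 := x.line.finrank_submodule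
  rw [delta]
  split_ifs with h
  · obtain ⟨p, hp, h4, h5⟩ := h
    have hnot : ∑ p : D.Δ, v (D.mark p) ∉ x.fst.space i ⊔ x.snd.space j := by
      rw [h2, sum_mark_mem_iff]
      intro hcon
      rcases hcon ⟨p, hp⟩ with h6 | h6
      · exact absurd h6 (not_lt.2 h4)
      · exact absurd h6 (not_lt.2 h5)
    have h7 := finrank_sup_span_singleton_of_notMem hnot
    have h8 := finrank_sup_add_finrank_inf_eq (x.fst.space i ⊔ x.snd.space j) x.line.submodule
    rw [← hA'] at h7
    rw [inf_comm]
    omega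
  · have hle : x.line.submodule ≤ x.fst.space i ⊔ x.snd.space j := by
      rw [hA', span_singleton_le_iff_mem, h2, sum_mark_mem_iff]
      intro p
      by_contra hcon
      simp only [Set.mem_union, Set.mem_ofPred_eq, not_or, not_lt] at hcon
      exact h ⟨p.1, p.2, hcon⟩
    rw [inf_eq_left.2 hle, h3]

theorem orbit_nonempty (D : DecoratedMatrix b c) (hbn : ∑ i, b i = n) : (D.orbit k n).Nonempty := by
  have hcard : Fintype.card D.Index = finrank k (Fin n → k) := by
    simp only [Fintype.card_sigma, Fintype.card_fin, D.row_sum, hbn, finrank_fin_fun]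
  let v : Basis D.Index k (Fin n → k) :=
    (finBasis k (Fin n → k)).reindex (Fintype.equivFinOfCardEq hcard).symm
  have hne : ∑ p : D.Δ, v (D.mark p) ≠ 0 := by
    intro h0
    obtain ⟨p, hp⟩ := D.nonempty
    have := (D.sum_mark_mem_iff v ∅).1 (by rw [h0]; exact zero_mem _) ⟨p, hp⟩
    exact this
  have hrow : ∀ i : Fin (q + 1),
      finrank k ↥(span k (v '' {t | t.1.val < i.val})) = partialSum b i := by
    intro i
    refine (D.finrank_span_image v fun a _ => a.val < i.val).trans ?_
    refine Finset.sum_congr rfl fun a _ => ?_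
    by_cases h : a.val < i.val <;> simp [h, D.row_sum]
  have hcol : ∀ j : Fin (r + 1),
      finrank k ↥(span k (v '' {t | t.2.1.val < j.val})) = partialSum c j := by
    intro j
    refine (D.finrank_span_image v fun _ d => d.val < j.val).trans ?_
    rw [Finset.sum_comm]
    refine Finset.sum_congr rfl fun d _ => ?_
    by_cases h : d.val < j.val <;> simp [h, D.col_sum]
  refine ⟨⟨Projectivization.mk k _ hne,
    { space := fun i => span k (v '' {t | t.1.val < i.val})
      space_zero := by simp
      space_last := by
        have : {t : D.Index | t.1.val < (Fin.last q).val} = Set.univ := by ext t; simp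
        rw [this, Set.image_univ, v.span_eq]
      mono := fun i j hij => span_mono (Set.image_mono fun t (ht : t.1.val < i.val) =>
        lt_of_lt_of_le ht hij)
      finrank_succ := fun i => by rw [hrow, hrow, partialSum_succ] },
    { space := fun j => span k (v '' {t | t.2.1.val < j.val})
      space_zero := by simp
      space_last := by
        have : {t : D.Index | t.2.1.val < (Fin.last r).val} = Set.univ := by ext t; simp
        rw [this, Set.image_univ, v.span_eq]
      mono := fun i j hij => span_mono (Set.image_mono fun t (ht : t.2.1.val < i.val) =>
        lt_of_lt_of_le ht hij)
      finrank_succ := fun i => by rw [hcol, hcol, partialSum_succ] }⟩,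
    v, fun i => rfl, fun j => rfl, Projectivization.submodule_mk _ _⟩

end DecoratedMatrix

theorem TripleFlag.submodule_smul_line (g : LinearMap.GeneralLinearGroup k (Fin n → k))
    (x : TripleFlag k n b c) :
    (g • x).line.submodule = x.line.submodule.map g.toLinearEquiv.toLinearMap := by
  change (g • x.line).submodule = _
  rw [Projectivization.generalLinearGroup_smul_def]
  induction x.line using Projectivization.ind with
  | h v hv =>
    rw [Projectivization.map_mk, Projectivization.submodule_mk, Projectivization.submodule_mk,
      map_span, Set.image_singleton]

theorem TripleFlag.ext_submodule {x y : TripleFlag k n b c}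
    (h1 : x.line.submodule = y.line.submodule) (h2 : ∀ i, x.fst.space i = y.fst.space i)
    (h3 : ∀ j, x.snd.space j = y.snd.space j) : x = y :=
  TripleFlag.ext (Projectivization.submodule_injective h1) (PartialFlag.ext (funext h2))
    (PartialFlag.ext (funext h3))

/-- The change of basis between two bases of the same type carries one triple flag to the other, and
a linear automorphism preserves the type. -/
theorem DecoratedMatrix.orbit_eq {D : DecoratedMatrix b c} {x : TripleFlag k n b c}
    (hx : x ∈ D.orbit k n) :
    D.orbit k n = MulAction.orbit (LinearMap.GeneralLinearGroup k (Fin n → k)) x := by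
  obtain ⟨v, hB, hC, hA⟩ := hx
  have hA' : x.line.submodule = span k {∑ p : D.Δ, v (D.mark p)} := hA
  ext y
  constructor
  · rintro ⟨w, hB', hC', hA''⟩
    have hA''' : y.line.submodule = span k {∑ p : D.Δ, w (D.mark p)} := hA''
    let e := v.equiv w (Equiv.refl _)
    have he : ∀ S : Set D.Index,
        (span k (v '' S)).map e.toLinearMap = span k (w '' S) := by
      intro S
      rw [map_span, Set.image_image]
      congr 1
      exact Set.image_congr fun t _ => by simp [e]
    refine ⟨LinearMap.GeneralLinearGroup.ofLinearEquiv e, TripleFlag.ext_submodule ?_ (fun i => ?_)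
      fun j => ?_⟩
    · rw [TripleFlag.submodule_smul_line, hA', hA''', map_span, Set.image_singleton]
      congr 2
      change e _ = _
      rw [map_sum]
      exact Finset.sum_congr rfl fun p _ => by simp [e]
    · rw [hB']
      change (x.fst.space i).map e.toLinearMap = _
      rw [hB, he]
    · rw [hC']
      change (x.snd.space j).map e.toLinearMap = _
      rw [hC, he]
  · rintro ⟨g, rfl⟩
    have hg : ∀ S : Set D.Index, (span k (v '' S)).map g.toLinearEquiv.toLinearMap =
        span k (v.map g.toLinearEquiv '' S) := by
      intro S
      rw [map_span, Set.image_image]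
      rfl
    refine ⟨v.map g.toLinearEquiv, fun i => ?_, fun j => ?_, ?_⟩
    · rw [← hg, ← hB]
      rfl
    · rw [← hg, ← hC]
      rfl
    · change (g • x).line.submodule = _
      rw [TripleFlag.submodule_smul_line, hA', map_span, Set.image_singleton]
      congr 2
      change g.toLinearEquiv _ = _
      rw [map_sum]
      rfl

end Orbits

/-! ### Existence of decorated matrices and the degeneration order. -/

section Classification

open Submodule Module

variable {k : Type*} [Field k] {n q r : ℕ} {b : Fin q → ℕ} {c : Fin r → ℕ}

/-- A family that complements `W'` in `W` and starts with a given vector. -/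
theorem exists_complementary_family {V : Type*} [AddCommGroup V] [Module k V]
    [FiniteDimensional k V] (W : Submodule k V) (m : ℕ) (W' : Submodule k V) (hle : W' ≤ W)
    (hm : finrank k W = m + finrank k W') (w : V) (hw : 0 < m → w ∈ W ∧ w ∉ W') :
    ∃ f : Fin m → V, (∀ i, f i ∈ W) ∧ W ≤ W' ⊔ span k (Set.range f) ∧
      ∀ h : 0 < m, f ⟨0, h⟩ = w := by
  induction m generalizing W' w with
  | zero =>
    refine ⟨Fin.elim0, fun i => i.elim0, ?_, fun h => absurd h (lt_irrefl 0)⟩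
    rw [eq_of_le_of_finrank_eq hle (by omega)]
    exact le_sup_left
  | succ m ih =>
    obtain ⟨h1, h2⟩ := hw (Nat.succ_pos m)
    have h3 := finrank_sup_span_singleton_of_notMem h2
    have h4 : W' ⊔ span k {w} ≤ W := sup_le hle (by simpa using h1)
    -- The recursion needs a new starting vector, which the dimension count supplies as long as `m`
    -- is positive.
    have hex : ∃ w', 0 < m → w' ∈ W ∧ w' ∉ W' ⊔ span k {w} := by
      by_contra hcon
      push Not at hcon
      have h5 : finrank k W ≤ finrank k ↥(W' ⊔ span k {w}) :=
        finrank_mono fun v hv => (hcon v).2 hv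
      have := (hcon 0).1
      omega
    obtain ⟨w', hw'⟩ := hex
    obtain ⟨f, hf, hf', -⟩ := ih (W' ⊔ span k {w}) h4 (by omega) w' hw'
    refine ⟨Fin.cons w f, fun i => Fin.cases h1 hf i, ?_, fun _ => rfl⟩
    rwa [Fin.range_cons, span_insert, ← sup_assoc]

namespace TripleFlag

/-- `B_i ∩ C_j`. -/
def meet (x : TripleFlag k n b c) (i : Fin (q + 1)) (j : Fin (r + 1)) : Submodule k (Fin n → k) :=
  x.fst.space i ⊓ x.snd.space j

/-- `B_{i-1} ∩ C_j + B_i ∩ C_{j-1}`. -/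
def meetLower (x : TripleFlag k n b c) (a : Fin q) (d : Fin r) : Submodule k (Fin n → k) :=
  x.meet a.castSucc d.succ ⊔ x.meet a.succ d.castSucc

/-- The relative position of the two flags. -/
noncomputable def relPos (x : TripleFlag k n b c) : Matrix (Fin q) (Fin r) ℕ := fun a d =>
  finrank k ↥(x.meet a.succ d.succ) - finrank k ↥(x.meetLower a d)

variable (x : TripleFlag k n b c)

theorem meet_mono {i i' : Fin (q + 1)} {j j' : Fin (r + 1)} (hi : i ≤ i') (hj : j ≤ j') :
    x.meet i j ≤ x.meet i' j' :=
  inf_le_inf (x.fst.mono hi) (x.snd.mono hj)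

theorem meetLower_le (a : Fin q) (d : Fin r) : x.meetLower a d ≤ x.meet a.succ d.succ :=
  sup_le (x.meet_mono a.castSucc_le_succ le_rfl) (x.meet_mono le_rfl d.castSucc_le_succ)

theorem finrank_meet_succ (a : Fin q) (d : Fin r) :
    finrank k ↥(x.meet a.succ d.succ) = x.relPos a d + finrank k ↥(x.meetLower a d) := by
  have := finrank_mono (x.meetLower_le a d)
  rw [relPos]
  omega

theorem meet_last (i : Fin (q + 1)) : x.meet i (Fin.last r) = x.fst.space i := by
  rw [meet, x.snd.space_last, inf_top_eq]

theorem last_meet (j : Fin (r + 1)) : x.meet (Fin.last q) j = x.snd.space j := by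
  rw [meet, x.fst.space_last, top_inf_eq]

theorem zero_meet (j : Fin (r + 1)) : x.meet 0 j = ⊥ := by
  rw [meet, x.fst.space_zero, bot_inf_eq]

theorem meet_zero (i : Fin (q + 1)) : x.meet i 0 = ⊥ := by
  rw [meet, x.snd.space_zero, inf_bot_eq]

/-- The two summands of `meetLower` intersect in `B_{i-1} ∩ C_{j-1}`. Thus `relPos` is a mixed
second difference of dimensions, and it telescopes along a row. -/
theorem finrank_meet_row (a : Fin q) (j : Fin (r + 1)) :
    finrank k ↥(x.meet a.succ j) =
      finrank k ↥(x.meet a.castSucc j) + partialSum (x.relPos a) j := by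
  induction j using Fin.induction with
  | zero => rw [meet_zero, meet_zero, partialSum_zero, add_zero]
  | succ d ih =>
    have h1 : x.meet a.castSucc d.succ ⊓ x.meet a.succ d.castSucc =
        x.meet a.castSucc d.castSucc := by
      refine le_antisymm (le_inf (inf_le_left.trans inf_le_left) (inf_le_right.trans inf_le_right))
        (le_inf (x.meet_mono le_rfl d.castSucc_le_succ) (x.meet_mono a.castSucc_le_succ le_rfl))
    have h2 := finrank_sup_add_finrank_inf_eq (x.meet a.castSucc d.succ) (x.meet a.succ d.castSucc)
    rw [h1] at h2
    have h3 := x.finrank_meet_succ a d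
    rw [meetLower] at h3
    rw [partialSum_succ]
    omega

theorem finrank_meet (i : Fin (q + 1)) (j : Fin (r + 1)) :
    finrank k ↥(x.meet i j) = partialSum (fun a => partialSum (x.relPos a) j) i :=
  eq_partialSum (F := fun i => finrank k ↥(x.meet i j)) (by
    rw [zero_meet, finrank_bot])
    (fun a => x.finrank_meet_row a j) i

theorem relPos_row_sum (a : Fin q) : ∑ d, x.relPos a d = b a := by
  have h1 := x.finrank_meet_row a (Fin.last r)
  rw [meet_last, meet_last, partialSum_last, x.fst.finrank_succ] at h1
  omega

theorem relPos_col_sum (d : Fin r) : ∑ a, x.relPos a d = c d := by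
  have h1 := x.finrank_meet (Fin.last q) d.succ
  have h2 := x.finrank_meet (Fin.last q) d.castSucc
  rw [last_meet, partialSum_last] at h1 h2
  simp only [partialSum_succ, Finset.sum_add_distrib] at h1
  rw [x.snd.finrank_succ] at h1
  omega

/-- Complements of the spaces `B_{i-1} ∩ C_j + B_i ∩ C_{j-1}` in `B_i ∩ C_j` combine to a basis that
is adapted to both flags. -/
theorem exists_basis (hbn : ∑ i, b i = n)
    (f : ∀ a d, Fin (x.relPos a d) → Fin n → k) (hf : ∀ a d i, f a d i ∈ x.meet a.succ d.succ)
    (hf' : ∀ a d, x.meet a.succ d.succ ≤ x.meetLower a d ⊔ span k (Set.range (f a d))) :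
    ∃ v : Basis (Σ a : Fin q, Σ d : Fin r, Fin (x.relPos a d)) k (Fin n → k),
      (∀ t, v t = f t.1 t.2.1 t.2.2) ∧
      (∀ i, x.fst.space i = span k (v '' {t | t.1.val < i.val})) ∧
      (∀ j, x.snd.space j = span k (v '' {t | t.2.1.val < j.val})) := by
  let g : (Σ a : Fin q, Σ d : Fin r, Fin (x.relPos a d)) → Fin n → k := fun t => f t.1 t.2.1 t.2.2
  have hg : ∀ i j, x.meet i j ≤ span k (g '' {t | t.1.val < i.val ∧ t.2.1.val < j.val}) := by
    intro i
    induction i using Fin.induction with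
    | zero => exact fun j => by rw [zero_meet]; exact bot_le
    | succ a iha =>
      intro j
      induction j using Fin.induction with
      | zero => rw [meet_zero]; exact bot_le
      | succ d ihd =>
        refine (hf' a d).trans (sup_le (sup_le ((iha _).trans ?_) (ihd.trans ?_)) (span_le.2 ?_))
        · refine span_mono (Set.image_mono fun t ht => ⟨lt_trans ht.1 ?_, ht.2⟩)
          exact Nat.lt_succ_self _
        · refine span_mono (Set.image_mono fun t ht => ⟨ht.1, lt_trans ht.2 ?_⟩)
          exact Nat.lt_succ_self _
        · rintro _ ⟨l, rfl⟩
          exact subset_span ⟨⟨a, d, l⟩, ⟨Nat.lt_succ_self _, Nat.lt_succ_self _⟩, rfl⟩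
  have htop : ⊤ ≤ span k (Set.range g) := by
    have h1 := hg (Fin.last q) (Fin.last r)
    rw [meet_last, x.fst.space_last] at h1
    exact h1.trans (span_mono (Set.image_subset_range _ _))
  have hcard : Fintype.card (Σ a : Fin q, Σ d : Fin r, Fin (x.relPos a d)) =
      finrank k (Fin n → k) := by
    simp only [Fintype.card_sigma, Fintype.card_fin, x.relPos_row_sum, hbn, finrank_fin_fun]
  refine ⟨basisOfTopLeSpanOfCardEqFinrank g htop hcard, fun t => ?_, fun i => ?_, fun j => ?_⟩
  · rw [coe_basisOfTopLeSpanOfCardEqFinrank]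
  · rw [coe_basisOfTopLeSpanOfCardEqFinrank]
    refine le_antisymm ?_ (span_le.2 ?_)
    · rw [← x.meet_last]
      exact (hg i _).trans (span_mono (Set.image_mono fun t ht => ht.1))
    · rintro _ ⟨t, ht, rfl⟩
      exact x.fst.mono (Nat.succ_le_of_lt ht : t.1.succ ≤ i) (hf _ _ _).1
  · rw [coe_basisOfTopLeSpanOfCardEqFinrank]
    refine le_antisymm ?_ (span_le.2 ?_)
    · rw [← x.last_meet]
      exact (hg _ j).trans (span_mono (Set.image_mono fun t ht => ht.2))
    · rintro _ ⟨t, ht, rfl⟩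
      exact x.snd.mono (Nat.succ_le_of_lt ht : t.2.1.succ ≤ j) (hf _ _ _).2

/-- The freedom in the first vector at each position is what allows the parts of a vector of `A` to
be built into the basis. -/
theorem exists_basis_of_start (hbn : ∑ i, b i = n) (w : Fin q → Fin r → Fin n → k)
    (hw : ∀ a d, 0 < x.relPos a d → w a d ∈ x.meet a.succ d.succ ∧ w a d ∉ x.meetLower a d) :
    ∃ v : Basis (Σ a : Fin q, Σ d : Fin r, Fin (x.relPos a d)) k (Fin n → k),
      (∀ a d (h : 0 < x.relPos a d), v ⟨a, d, ⟨0, h⟩⟩ = w a d) ∧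
      (∀ i, x.fst.space i = span k (v '' {t | t.1.val < i.val})) ∧
      (∀ j, x.snd.space j = span k (v '' {t | t.2.1.val < j.val})) := by
  have key : ∀ a d, ∃ f : Fin (x.relPos a d) → Fin n → k, (∀ i, f i ∈ x.meet a.succ d.succ) ∧
      x.meet a.succ d.succ ≤ x.meetLower a d ⊔ span k (Set.range f) ∧
      ∀ h : 0 < x.relPos a d, f ⟨0, h⟩ = w a d := fun a d =>
    exists_complementary_family _ _ _ (x.meetLower_le a d) (x.finrank_meet_succ a d) _ (hw a d)
  choose f hf hf' hf0 using key
  obtain ⟨v, hv, hB, hC⟩ := x.exists_basis hbn f hf hf'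
  exact ⟨v, fun a d h => (hv ⟨a, d, ⟨0, h⟩⟩).trans (hf0 a d h), hB, hC⟩

theorem exists_start : ∃ w : Fin q → Fin r → Fin n → k, ∀ a d, 0 < x.relPos a d →
    w a d ∈ x.meet a.succ d.succ ∧ w a d ∉ x.meetLower a d := by
  have key : ∀ a d, ∃ w : Fin n → k, 0 < x.relPos a d →
      w ∈ x.meet a.succ d.succ ∧ w ∉ x.meetLower a d := by
    intro a d
    by_contra hcon
    push Not at hcon
    have h1 : finrank k ↥(x.meet a.succ d.succ) ≤ finrank k ↥(x.meetLower a d) :=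
      finrank_mono fun v hv => (hcon v).2 hv
    have h2 := (hcon 0).1
    have h3 := x.finrank_meet_succ a d
    omega
  choose w hw using key
  exact ⟨w, hw⟩

/-- Every triple flag has a decorated matrix. -/
theorem exists_mem_orbit (hbn : ∑ i, b i = n) : ∃ D : DecoratedMatrix b c, x ∈ D.orbit k n := by
  classical
  obtain ⟨w₀, hw₀⟩ := x.exists_start
  obtain ⟨v₀, -, hB₀, hC₀⟩ := x.exists_basis_of_start hbn w₀ hw₀
  have hmeet : ∀ i j, x.meet i j = span k (v₀ '' {t | t.1.val < i.val ∧ t.2.1.val < j.val}) := by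
    intro i j
    rw [meet, hB₀, hC₀, span_image_inf_span_image]
    rfl
  set z := v₀.repr x.line.rep with hz
  let pos : (Σ a : Fin q, Σ d : Fin r, Fin (x.relPos a d)) → Fin q × Fin r := fun t => (t.1, t.2.1)
  let S : Finset (Fin q × Fin r) := z.support.image pos
  -- The maximal positions of the support of a vector spanning the line. Smaller positions can be
  -- absorbed, since their basis vectors lie in the same `B_i ∩ C_j`.
  let Δ : Finset (Fin q × Fin r) := S.filter fun p => ∀ s ∈ S, p ≤ s → s = p
  have hS : ∀ {t}, z t ≠ 0 → pos t ∈ S := fun h =>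
    Finset.mem_image_of_mem _ (Finsupp.mem_support_iff.2 h)
  have hμ : ∀ s, ∃ p, s ∈ S → p ∈ Δ ∧ s ≤ p := by
    intro s
    by_cases hs : s ∈ S
    · obtain ⟨p, hsp, hp⟩ := S.exists_le_maximal hs
      exact ⟨p, fun _ => ⟨Finset.mem_filter.2 ⟨hp.1, fun s' hs' h => le_antisymm (hp.2 hs' h) h⟩, hsp⟩⟩
    · exact ⟨s, fun h => absurd h hs⟩
  choose μ hμ using hμ
  have hμΔ : ∀ p ∈ Δ, μ p = p := fun p hp =>
    (Finset.mem_filter.1 hp).2 _ (Finset.mem_filter.1 (hμ p (Finset.mem_filter.1 hp).1).1).1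
      (hμ p (Finset.mem_filter.1 hp).1).2
  -- Every term of the vector is assigned to one maximal position above its own, and `w p` collects
  -- the terms assigned to `p`.
  let w : Fin q × Fin r → Fin n → k := fun p => v₀.repr.symm (z.filter fun t => μ (pos t) = p)
  have hsum : ∑ p ∈ Δ, w p = x.line.rep := by
    refine v₀.repr.injective ?_
    rw [map_sum]
    ext t
    simp only [w, LinearEquiv.apply_symm_apply, Finsupp.finsetSum_apply, Finsupp.filter_apply]
    rw [Finset.sum_ite_eq]
    by_cases h : z t = 0
    · rw [h, ite_self]
    · rw [if_pos (hμ _ (hS h)).1]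
  have hpos : ∀ p ∈ Δ, 0 < x.relPos p.1 p.2 := by
    intro p hp
    obtain ⟨⟨a, d, l⟩, -, rfl⟩ := Finset.mem_image.1 (Finset.mem_filter.1 hp).1
    exact l.pos
  have hw : ∀ p ∈ Δ, w p ∈ x.meet p.1.succ p.2.succ ∧ w p ∉ x.meetLower p.1 p.2 := by
    intro p hp
    constructor
    · rw [hmeet, v₀.mem_span_image]
      intro t ht
      simp only [w, LinearEquiv.apply_symm_apply, Finset.mem_coe, Finsupp.mem_support_iff,
        Finsupp.filter_apply, ne_eq, ite_eq_right_iff, Classical.not_imp] at ht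
      obtain ⟨h1, h2⟩ := ht
      have h3 := (hμ _ (hS h2)).2
      rw [h1] at h3
      exact ⟨Nat.lt_succ_of_le h3.1, Nat.lt_succ_of_le h3.2⟩
    -- The position `p` is assigned to itself, so `w p` keeps a term there, whereas `meetLower` is
    -- spanned by basis vectors at other positions.
    · intro hmem
      have h1 : x.meetLower p.1 p.2 ≤ span k (v₀ '' {t | pos t ≠ p}) := by
        rw [meetLower, hmeet, hmeet]
        refine sup_le (span_mono (Set.image_mono ?_)) (span_mono (Set.image_mono ?_))
        · rintro t ⟨ht, -⟩ rfl
          exact lt_irrefl _ ht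
        · rintro t ⟨-, ht⟩ rfl
          exact lt_irrefl _ ht
      obtain ⟨t, ht, htp⟩ := Finset.mem_image.1 (Finset.mem_filter.1 hp).1
      have h2 := v₀.mem_span_image.1 (h1 hmem)
      refine h2 (?_ : t ∈ _) htp
      simp only [w, LinearEquiv.apply_symm_apply, Finset.mem_coe, Finsupp.mem_support_iff,
        Finsupp.filter_apply]
      rw [htp, if_pos (hμΔ p hp)]
      exact Finsupp.mem_support_iff.1 ht
  obtain ⟨v, hv, hB, hC⟩ := x.exists_basis_of_start hbn
    (fun a d => if (a, d) ∈ Δ then w (a, d) else w₀ a d) (by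
      intro a d h
      split_ifs with hΔ
      · exact hw _ hΔ
      · exact hw₀ a d h)
  have hΔ : Δ.Nonempty := by
    rw [Finset.nonempty_iff_ne_empty]
    intro h0
    rw [h0, Finset.sum_empty] at hsum
    exact x.line.rep_nonzero hsum.symm
  refine ⟨⟨x.relPos, x.relPos_row_sum, x.relPos_col_sum, Δ, hΔ, ?_, hpos⟩, v, hB, hC, ?_⟩
  -- Distinct maximal positions are incomparable in the product order, which is the northeast to
  -- southwest condition.
  · intro p hp p' hp' hne
    have h1 : ¬ p ≤ p' := fun h =>
      hne ((Finset.mem_filter.1 hp).2 _ (Finset.mem_filter.1 hp').1 h).symm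
    have h2 : ¬ p' ≤ p := fun h => hne ((Finset.mem_filter.1 hp').2 _ (Finset.mem_filter.1 hp).1 h)
    rw [Prod.le_def] at h1 h2
    rcases lt_trichotomy p.1 p'.1 with h | h | h
    · exact Or.inl ⟨h, not_le.1 fun h' => h1 ⟨h.le, h'⟩⟩
    · rcases le_total p.2 p'.2 with h' | h'
      · exact absurd ⟨h.le, h'⟩ h1
      · exact absurd ⟨h.ge, h'⟩ h2
    · exact Or.inr ⟨h, not_le.1 fun h' => h2 ⟨h.le, h'⟩⟩
  · rw [Projectivization.submodule_eq, ← hsum, ← Finset.sum_coe_sort]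
    congr 2
    refine Finset.sum_congr rfl fun p _ => ?_
    rw [hv, if_pos p.2]

/-- The dimension formula, applied to `B_i`, `C_j` and then to `B_i + C_j`, `A`. It turns upper
bounds on sums into lower bounds on intersections. -/
theorem rankNum_add_sumRank (i : Fin (q + 1)) (j : Fin (r + 1)) :
    x.rankNum i j + x.sumRank i j = partialSum b i + partialSum c j ∧
      x.rankNumBar i j + x.sumRankBar i j = 1 + partialSum b i + partialSum c j := by
  have h1 := finrank_sup_add_finrank_inf_eq (x.fst.space i) (x.snd.space j)
  have h2 := finrank_sup_add_finrank_inf_eq (x.fst.space i ⊔ x.snd.space j) x.line.submodule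
  rw [x.fst.finrank_space, x.snd.finrank_space] at h1
  rw [x.line.finrank_submodule] at h2
  rw [rankNum, rankNumBar, sumRank, sumRankBar, ← sup_assoc, inf_comm x.line.submodule]
  omega

/-- Both triple flags have a decorated matrix, and equal ranks force the two matrices to coincide.
-/
theorem mem_orbit_iff (hbn : ∑ i, b i = n) {x x' : TripleFlag k n b c} :
    x ∈ MulAction.orbit (LinearMap.GeneralLinearGroup k (Fin n → k)) x' ↔
      ∀ i j, x.sumRank i j = x'.sumRank i j ∧ x.sumRankBar i j = x'.sumRankBar i j := by
  obtain ⟨D, hD⟩ := x.exists_mem_orbit hbn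
  obtain ⟨D', hD'⟩ := x'.exists_mem_orbit hbn
  rw [← DecoratedMatrix.orbit_eq hD']
  constructor
  · intro h i j
    have h1 := DecoratedMatrix.rankNum_of_mem_orbit h i j
    have h2 := DecoratedMatrix.rankNum_of_mem_orbit hD' i j
    have h3 := x.rankNum_add_sumRank i j
    have h4 := x'.rankNum_add_sumRank i j
    omega
  · intro h
    have : D = D' := DecoratedMatrix.eq_of_rankNum_eq fun i j => by
      have h1 := DecoratedMatrix.rankNum_of_mem_orbit hD i j
      have h2 := DecoratedMatrix.rankNum_of_mem_orbit hD' i j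
      have h3 := x.rankNum_add_sumRank i j
      have h4 := x'.rankNum_add_sumRank i j
      have h5 := h i j
      omega
    exact this ▸ hD

theorem mem_closure_orbit_iff [Infinite k] (hbn : ∑ i, b i = n) (hcn : ∑ j, c j = n)
    {x x' : TripleFlag k n b c} :
    x ∈ closure (MulAction.orbit (LinearMap.GeneralLinearGroup k (Fin n → k)) x') ↔
      ∀ i j, x'.rankNum i j ≤ x.rankNum i j ∧ x'.rankNumBar i j ≤ x.rankNumBar i j := by
  have hiff : (∀ i j, x'.rankNum i j ≤ x.rankNum i j ∧ x'.rankNumBar i j ≤ x.rankNumBar i j) ↔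
      ∀ i j, x.sumRank i j ≤ x'.sumRank i j ∧ x.sumRankBar i j ≤ x'.sumRankBar i j := by
    refine forall_congr' fun i => forall_congr' fun j => ?_
    have h3 := x.rankNum_add_sumRank i j
    have h4 := x'.rankNum_add_sumRank i j
    omega
  rw [hiff]
  constructor
  · intro hx i j
    have h := sumRank_le_of_mem_closure hx i j (m := x'.sumRank i j)
    have h' := sumRank_le_of_mem_closure hx i j (m := x'.sumRankBar i j)
    exact ⟨h.1 fun y hy => ((mem_orbit_iff hbn).1 hy i j).1.le,
      h'.2 fun y hy => ((mem_orbit_iff hbn).1 hy i j).2.le⟩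
  · intro h
    obtain ⟨y, y', hy, hy', hle⟩ := exists_frames hbn hcn h
    refine mem_closure_of_mem_polyHull hy
      (mem_polyHull_rankCell (by simp) (hy.isFramed hbn hcn) (hy'.isFramed hbn hcn) hle) ?_
    -- A frame in the cell of `y'` defines a triple flag whose ranks, read off at the partial sums,
    -- are those of `x'`; hence it is in the orbit of `x'`.
    rintro z ⟨hz, hranks⟩
    obtain ⟨w, hw⟩ := hz.exists_tripleFlag (b := b) (c := c) hbn hcn
    refine ⟨w, (mem_orbit_iff hbn).2 fun i j => ?_, hw⟩
    rw [← (hw.frameRank i j).1, ← (hw.frameRank i j).2, ← (hy'.frameRank i j).1,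
      ← (hy'.frameRank i j).2]
    exact hranks _ _

end TripleFlag

end Classification

theorem mainTheorem1 {k : Type*} [Field k] [Infinite k] {n q r : ℕ}
    (b : Fin q → ℕ) (c : Fin r → ℕ)
    (hb : ∀ i, 0 < b i) (hc : ∀ j, 0 < c j) (hbn : ∑ i, b i = n) (hcn : ∑ j, c j = n) :
    -- every triple flag lies in exactly one of the sets `F_{M,Δ}`
    (∀ x : TripleFlag k n b c, ∃! D : DecoratedMatrix b c, x ∈ D.orbit k n) ∧
    -- `F_{M,Δ}` is a `GL(V)`-orbit, with the rank numbers `r_ij(M)` and `r_⟨ij⟩(M,Δ)`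
    (∀ D : DecoratedMatrix b c, (D.orbit k n).Nonempty ∧ ∀ x ∈ D.orbit k n,
      D.orbit k n = MulAction.orbit (LinearMap.GeneralLinearGroup k (Fin n → k)) x ∧
      ∀ i j, x.rankNum i j = D.rankNum i j ∧ x.rankNumBar i j = D.rankNumBar i j) ∧
    -- the degeneration order on decorated matrices is the rank order
    (∀ D D' : DecoratedMatrix b c,
      D.orbit k n ⊆ closure (D'.orbit k n) ↔
        ∀ i j, D'.rankNum i j ≤ D.rankNum i j ∧ D'.rankNumBar i j ≤ D.rankNumBar i j) ∧
    -- the same for triple flags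
    (∀ x x' : TripleFlag k n b c,
      x ∈ closure (MulAction.orbit (LinearMap.GeneralLinearGroup k (Fin n → k)) x') ↔
        ∀ i j, x'.rankNum i j ≤ x.rankNum i j ∧ x'.rankNumBar i j ≤ x.rankNumBar i j) := by
  refine ⟨fun x => ?_, fun D => ⟨D.orbit_nonempty hbn, fun x hx =>
    ⟨DecoratedMatrix.orbit_eq hx, DecoratedMatrix.rankNum_of_mem_orbit hx⟩⟩, fun D D' => ?_,
    fun x x' => TripleFlag.mem_closure_orbit_iff hbn hcn⟩
  · obtain ⟨D, hD⟩ := x.exists_mem_orbit hbn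
    refine ⟨D, hD, fun D' hD' => DecoratedMatrix.eq_of_rankNum_eq fun i j => ?_⟩
    have h1 := DecoratedMatrix.rankNum_of_mem_orbit hD i j
    have h2 := DecoratedMatrix.rankNum_of_mem_orbit hD' i j
    exact ⟨h2.1.symm.trans h1.1, h2.2.symm.trans h1.2⟩
  · obtain ⟨x', hx'⟩ := D'.orbit_nonempty (k := k) hbn
    have key : ∀ x ∈ D.orbit k n, x ∈ closure (D'.orbit k n) ↔
        ∀ i j, D'.rankNum i j ≤ D.rankNum i j ∧ D'.rankNumBar i j ≤ D.rankNumBar i j := by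
      intro x hx
      rw [DecoratedMatrix.orbit_eq hx', TripleFlag.mem_closure_orbit_iff hbn hcn]
      refine forall_congr' fun i => forall_congr' fun j => ?_
      rw [(DecoratedMatrix.rankNum_of_mem_orbit hx i j).1,
        (DecoratedMatrix.rankNum_of_mem_orbit hx i j).2,
        (DecoratedMatrix.rankNum_of_mem_orbit hx' i j).1,
        (DecoratedMatrix.rankNum_of_mem_orbit hx' i j).2]
    obtain ⟨x, hx⟩ := D.orbit_nonempty (k := k) hbn
    exact ⟨fun h => (key x hx).1 (h hx), fun h y hy => (key y hy).2 h⟩
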